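/- Let $n\ge 1$ and $1<p<\infty$. Let $\Phi:[0,\infty)\to[0,\infty)$ be a Young function, that is, continuous, convex and strictly increasing with $\Phi(0)=0$ and $\Phi(t)\to\infty$ as $t\to\infty$, and let $\bar\Phi(s)=\sup_{t>0}\{st-\Phi(t)\}\in[0,\infty]$, $s\ge 0$, be its complementary function. Consider the condition $$(\ast)\qquad \int_c^\infty \frac{\bar\Phi(t)\,[\log(e+\bar\Phi(t))]^{n-1}}{t^{p}}\,\frac{dt}{t}<\infty\quad\text{for some } c>0,$$ i.e. $\bar\Phi\in B_p^*$ (the integrand is $\infty$ where $\bar\Phi=\infty$). A rectangle is a bounded open rectangle $R\subset\mathbb R^n$ with sides parallel to the coordinate axes. The strong maximal function is $M_{\mathcal R}f(x)=\sup_{R\ni x}\frac1{|R|}\int_R|f|\,dy$, the supremum being over rectangles. For a measurable $g\ge 0$ put $\|g\|_{\Phi,R}=\inf\{\lambda>0:\frac1{|R|}\int_R\Phi(g/\lambda)\,dx\le 1\}$ (with $\Phi(\infty)=\infty$, $\inf\emptyset=\infty$). A weight is a measurable function $w:\mathbb R^n\to[0,\infty)$ with $\int_R w\,dx<\infty$ for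 all rectangles $R$; $v^{-1}=\infty$ where $v=0$, and $0\cdot\infty=0$. The function $u^p$ satisfies condition (A) if there are $0<\lambda<1$ and $0<c(\lambda)<\infty$ with $\int_{\{M_{\mathcal R}(\chi_E)>\lambda\}}u^p\,dx\le c(\lambda)\int_E u^p\,dx$ for all measurable $E\subset\mathbb R^n$. A pair of weights $(u,v)$ satisfies the bump condition if there is a constant $K>0$ such that for all rectangles $R$ $$\Big(\frac1{|R|}\int_R u^p\,dx\Big)^{1/p}\,\|v^{-1}\|_{\Phi,R}\le K .$$ We say that $M_{\mathcal R}:L^p(v^p)\to L^p(u^p)$ if there is a constant $C<\infty$ such that $\int_{\mathbb R^n}(u\,M_{\mathcal R}f)^p\,dx\le C\int_{\mathbb R^n}(vf)^p\,dx$ for all non-negative measurable functions $f$ on $\mathbb R^n$. (i) Suppose that $\bar\Phi$ satisfies $(\ast)$. If $(u,v)$ is a pair of weights that satisfies the bump condition and $u^p$ satisfies condition (A), then $M_{\mathcal R}:L^p(v^p)\to L^p(u^p)$. (ii) Conversely, suppose that $M_{\mathcal R}:L^p(v^p)\to L^p(u^p)$ for every pair of weights $(u,v)$ that satisfies the bump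 condition. Then $\bar\Phi$ satisfies $(\ast)$. -/

import Mathlib

open scoped NNReal ENNReal
open MeasureTheory

noncomputable section

namespace TwoWeight

/-- Young functions `[0,∞) → [0,∞)`. -/
structure IsYoung (Φ : ℝ≥0 → ℝ≥0) : Prop where
  continuous : Continuous Φ
  convex : ConvexOn ℝ≥0 Set.univ Φ
  strictMono : StrictMono Φ
  map_zero : Φ 0 = 0
  tendsto : Filter.Tendsto Φ Filter.atTop Filter.atTop

/-- The extension of `Φ` to `[0,∞]` by `Φ(∞) = ∞`. It is needed for `v⁻¹`, which equals `∞`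
where the weight `v` vanishes. -/
def extend (Φ : ℝ≥0 → ℝ≥0) (x : ℝ≥0∞) : ℝ≥0∞ :=
  if x = ⊤ then ⊤ else (Φ x.toNNReal : ℝ≥0∞)

/-- The complementary function `Φ̄(s) = sup_{t > 0} (s t - Φ(t))`, with values in `[0,∞]`.
The truncated subtraction does not change the supremum: for a Young function `s t - Φ(t)` tends
to `0` as `t → 0`, so the supremum is nonnegative anyway. -/
def complementary (Φ : ℝ≥0 → ℝ≥0) (s : ℝ≥0) : ℝ≥0∞ :=
  ⨆ (t : ℝ≥0) (_ : 0 < t), ((s : ℝ≥0∞) * t - Φ t)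

/-- `Φ_n(x) = x [log (e + x)]^(n-1)` on `[0,∞]`; the value at `∞` is `∞`. -/
def logBump (n : ℕ) (x : ℝ≥0∞) : ℝ≥0∞ :=
  x * ENNReal.ofReal (Real.log (Real.exp 1 + x.toReal)) ^ (n - 1)

/-- The strong `B_p^*` condition in dimension `n`: for some `c > 0`,
`∫_c^∞ Φ_n(Ψ(t)) t^{-p} dt/t < ∞`. -/
def StrongBp (n : ℕ) (p : ℝ) (Ψ : ℝ≥0 → ℝ≥0∞) : Prop :=
  ∃ c : ℝ, 0 < c ∧
    ∫⁻ t in Set.Ioi c,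
      logBump n (Ψ t.toNNReal) / ENNReal.ofReal (t ^ p) / ENNReal.ofReal t < ⊤

/-- Bounded open rectangles with sides parallel to the coordinate axes. -/
def IsRectangle {n : ℕ} (R : Set (Fin n → ℝ)) : Prop :=
  ∃ a b : Fin n → ℝ, (∀ i, a i < b i) ∧ R = Set.univ.pi fun i => Set.Ioo (a i) (b i)

/-- The strong maximal function `M_R f(x) = sup_{R ∋ x} |R|⁻¹ ∫_R |f|`. -/
def strongMaximal {n : ℕ} (f : (Fin n → ℝ) → ℝ) (x : Fin n → ℝ) : ℝ≥0∞ :=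
  ⨆ (R : Set (Fin n → ℝ)) (_ : IsRectangle R) (_ : x ∈ R), ⨍⁻ y in R, ‖f y‖ₑ ∂volume

/-- The normalized Luxemburg norm `‖g‖_{Φ,R}` of a nonnegative function; it is `∞` if no `l`
is admissible. -/
def luxemburgNorm {n : ℕ} (Φ : ℝ≥0 → ℝ≥0) (R : Set (Fin n → ℝ))
    (g : (Fin n → ℝ) → ℝ≥0∞) : ℝ≥0∞ :=
  ⨅ (l : ℝ≥0) (_ : 0 < l) (_ : ⨍⁻ x in R, extend Φ (g x / l) ∂volume ≤ 1), (l : ℝ≥0∞)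

/-- Weights: nonnegative measurable functions with finite integral over every rectangle. -/
def IsWeight {n : ℕ} (w : (Fin n → ℝ) → ℝ≥0) : Prop :=
  Measurable w ∧ ∀ R : Set (Fin n → ℝ), IsRectangle R → ∫⁻ x in R, (w x : ℝ≥0∞) < ⊤

/-- Condition (A) for the measure `w dx`: `w {M_R χ_E > l} ≤ c w(E)` for some `0 < l < 1`,
`0 < c < ∞` and all measurable `E`. -/
def ConditionA {n : ℕ} (w : (Fin n → ℝ) → ℝ≥0∞) : Prop :=
  ∃ l : ℝ, 0 < l ∧ l < 1 ∧ ∃ c : ℝ≥0, 0 < c ∧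
    ∀ E : Set (Fin n → ℝ), MeasurableSet E →
      ∫⁻ x in {x | ENNReal.ofReal l < strongMaximal (E.indicator fun _ => (1 : ℝ)) x}, w x
        ≤ c * ∫⁻ x in E, w x

/-- The bump condition: for some `K > 0`, `(|R|⁻¹ ∫_R u^p)^{1/p} ‖v⁻¹‖_{Φ,R} ≤ K` for all
rectangles `R`. -/
def BumpCondition {n : ℕ} (p : ℝ) (Φ : ℝ≥0 → ℝ≥0) (u v : (Fin n → ℝ) → ℝ≥0) : Prop :=
  ∃ K : ℝ≥0, 0 < K ∧ ∀ R : Set (Fin n → ℝ), IsRectangle R →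
    (⨍⁻ x in R, (u x : ℝ≥0∞) ^ p ∂volume) ^ (1 / p) *
      luxemburgNorm Φ R (fun x => (v x : ℝ≥0∞)⁻¹) ≤ K

/-- `M_R : L^p(v^p) → L^p(u^p)`: there is `C < ∞` with `∫ (u M_R f)^p ≤ C ∫ (v f)^p` for all
nonnegative measurable `f`. -/
def StrongMaximalBounded {n : ℕ} (p : ℝ) (u v : (Fin n → ℝ) → ℝ≥0) : Prop :=
  ∃ C : ℝ≥0, ∀ f : (Fin n → ℝ) → ℝ, Measurable f → (∀ x, 0 ≤ f x) →
    ∫⁻ x, ((u x : ℝ≥0∞) * strongMaximal f x) ^ p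
      ≤ C * ∫⁻ x, ((v x : ℝ≥0∞) * ENNReal.ofReal (f x)) ^ p

end TwoWeight

end

open TwoWeight

noncomputable section

namespace TwoWeight

/-! ### Layer-cake formulas for functions with values in `[0,∞]` -/

/-! Sufficiency. Among finitely many rectangles, taken in order of decreasing average of `f`, keep a
rectangle only if the ones already kept cover at most the fraction `l` of it
(`exists_scattered_subfamily`). The kept `R i` then have disjoint parts `E i` of comparable measure.
Every rectangle of average above `t` is covered in proportion more than `l` by kept ones of average
above `t`, so condition (A) bounds `∫ (u M f)^p` by the sum of `(avg f)^p u^p(R i)` over the kept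
family (`ConditionA.exists_lintegral_rpow_le`). Young's inequality and the bump condition replace
each term by `‖v f‖^p |E i|`, with the Luxemburg norm of `Φ̄` on `R i`. Since the `E i` are
disjoint, this sum is at most the p-th power integral of the Orlicz maximal function of `g = v f`.

That integral is controlled by the endpoint estimate `|{M h > 1}| ≤ C ∫_{h > δ} h log(e + h)^(n-1)`,
which comes from iterating one-dimensional maximal functions, each one after the first costing a
logarithm (`exists_iterated_maximal`). With `h = Φ̄(g / t)`, integrating in `t` and substituting `t
= g / r` leaves `∫ g^p` times the integral in (∗).

Necessity. One pair suffices: `u = Φ⁻¹(H)` with `H(x) = ∏ (1 + |x i|)`, and `v = ∏ (1 + (x i)²)`.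
Averages of `1 / v` over rectangles containing `x` are at most `8^n / H(x)`, which with convexity of
`Φ` gives the bump condition. For the indicator `f` of a cube, `M f ≥ 1 / H`, so boundedness yields
`∫ (Φ⁻¹(H) / H)^p < ∞`. The set where `Φ⁻¹(H) / H > 1 / r` contains `{H < Φ̄(r)}`, whose measure is
at least a multiple of `Φ̄(r) log(e + Φ̄(r))^(n-1)` for large `r`; the layer-cake formula with `t =
1 / r` then gives (∗). -/

theorem measurable_indicator_lt {α : Type*} [MeasurableSpace α] {f : α → ℝ≥0∞}
    (hf : Measurable f) (φ : ℝ → ℝ≥0∞) (hφ : Measurable φ) :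
    Measurable fun q : α × ℝ => if ENNReal.ofReal q.2 < f q.1 then φ q.2 else 0 := by
  refine Measurable.ite ?_ (hφ.comp measurable_snd) measurable_const
  exact measurableSet_lt (ENNReal.measurable_ofReal.comp measurable_snd) (hf.comp measurable_fst)

theorem setLIntegral_ite_lt_coe (φ : ℝ → ℝ≥0∞) (s : ℝ) (hs : 0 ≤ s) (a : ℝ≥0) :
    ∫⁻ t in Set.Ioi s, (if ENNReal.ofReal t < a then φ t else 0) =
      ∫⁻ t in Set.Ioo s (a : ℝ), φ t := by
  have h : ∀ t ∈ Set.Ioi s, (if ENNReal.ofReal t < a then φ t else 0) =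
      (Set.Iio (a : ℝ)).indicator φ t := by
    intro t ht
    have ht0 : 0 ≤ t := hs.trans (le_of_lt ht)
    have : ENNReal.ofReal t < a ↔ t < a := by
      rw [← ENNReal.ofReal_coe_nnreal, ENNReal.ofReal_lt_ofReal_iff_of_nonneg ht0]
    simp [Set.indicator, this]
  rw [setLIntegral_congr_fun measurableSet_Ioi h, lintegral_indicator measurableSet_Iio,
    Measure.restrict_restrict measurableSet_Iio, Set.inter_comm, Set.Ioi_inter_Iio]

theorem rpow_eq_lintegral {p : ℝ} (hp : 0 < p) (a : ℝ≥0∞) :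
    a ^ p = ∫⁻ t in Set.Ioi (0 : ℝ),
      if ENNReal.ofReal t < a then ENNReal.ofReal (p * t ^ (p - 1)) else 0 := by
  have key : ∀ a : ℝ≥0, (a : ℝ≥0∞) ^ p = ∫⁻ t in Set.Ioi (0 : ℝ),
      if ENNReal.ofReal t < a then ENNReal.ofReal (p * t ^ (p - 1)) else 0 := by
    intro a
    rw [setLIntegral_ite_lt_coe _ 0 le_rfl]
    have hi : IntervalIntegrable (fun t : ℝ => p * t ^ (p - 1)) volume 0 a :=
      (intervalIntegral.intervalIntegrable_rpow' (by linarith)).const_mul p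
    have hnn : 0 ≤ᵐ[volume.restrict (Set.Ioc (0 : ℝ) a)] fun t : ℝ => p * t ^ (p - 1) :=
      (ae_restrict_iff' measurableSet_Ioc).2 (Filter.Eventually.of_forall fun t ht =>
        mul_nonneg hp.le (Real.rpow_nonneg ht.1.le _))
    rw [restrict_Ioo_eq_restrict_Ioc]
    rw [← ofReal_integral_eq_lintegral_ofReal
      ((intervalIntegrable_iff_integrableOn_Ioc_of_le a.coe_nonneg).1 hi) hnn,
      ← intervalIntegral.integral_of_le a.coe_nonneg, intervalIntegral.integral_const_mul,
      integral_rpow (Or.inl (by linarith))]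
    have : p * (((a : ℝ) ^ (p - 1 + 1) - 0 ^ (p - 1 + 1)) / (p - 1 + 1)) = (a : ℝ) ^ p := by
      rw [sub_add_cancel, Real.zero_rpow hp.ne']; field_simp; ring
    rw [this, ← ENNReal.ofReal_rpow_of_nonneg a.coe_nonneg hp.le, ENNReal.ofReal_coe_nnreal]
  induction a with
  | coe a => exact key a
  | top =>
    rw [ENNReal.top_rpow_of_pos hp]
    symm
    -- The finite case at `a^(1/p)` shows that the integral dominates every finite `a`.
    have h1 : ∀ a : ℝ≥0, (a : ℝ≥0∞) ≤ ∫⁻ t in Set.Ioi (0 : ℝ),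
        if ENNReal.ofReal t < ⊤ then ENNReal.ofReal (p * t ^ (p - 1)) else 0 := by
      intro a
      have h2 := key (a ^ (1 / p))
      rw [ENNReal.coe_rpow_of_nonneg _ (by positivity), ← ENNReal.rpow_mul,
        one_div_mul_cancel hp.ne', ENNReal.rpow_one] at h2
      rw [h2]
      refine lintegral_mono fun t => ?_
      rw [if_pos (ENNReal.ofReal_lt_top (r := t))]
      split_ifs
      · exact le_rfl
      · exact zero_le
    exact ENNReal.eq_top_of_forall_nnreal_le h1

theorem lintegral_rpow_eq_lintegral_meas_lt {α : Type*} [MeasurableSpace α] (μ : Measure α)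
    [SFinite μ] {p : ℝ} (hp : 0 < p) {f : α → ℝ≥0∞} (hf : Measurable f) :
    ∫⁻ x, f x ^ p ∂μ = ∫⁻ t in Set.Ioi (0 : ℝ),
      ENNReal.ofReal (p * t ^ (p - 1)) * μ {x | ENNReal.ofReal t < f x} := by
  simp_rw [rpow_eq_lintegral hp]
  rw [lintegral_lintegral_swap]
  · refine lintegral_congr fun t => ?_
    have : ∀ x, (if ENNReal.ofReal t < f x then ENNReal.ofReal (p * t ^ (p - 1)) else 0) =
        {x | ENNReal.ofReal t < f x}.indicator
          (fun _ => ENNReal.ofReal (p * t ^ (p - 1))) x := fun x => by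
      simp [Set.indicator]
    simp_rw [this]
    rw [lintegral_indicator (measurableSet_lt measurable_const hf), setLIntegral_const]
  · exact (measurable_indicator_lt hf (fun t => ENNReal.ofReal (p * t ^ (p - 1)))
      (by fun_prop)).aemeasurable

/-- If `a > s`, the interval `(s / 2, a)` has length at least `a / 2`. -/
theorem ite_lt_le_two_mul_lintegral {s : ℝ} (hs : 0 < s) (a : ℝ≥0∞) :
    (if ENNReal.ofReal s < a then a else 0) ≤
      2 * ∫⁻ r in Set.Ioi (s / 2), if ENNReal.ofReal r < a then 1 else 0 := by
  split_ifs with h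
  swap
  · exact zero_le
  induction a with
  | coe a =>
    have hsa : s < a := by
      rwa [← ENNReal.ofReal_coe_nnreal, ENNReal.ofReal_lt_ofReal_iff_of_nonneg hs.le] at h
    rw [setLIntegral_ite_lt_coe _ _ (by positivity)]
    simp only [lintegral_const, MeasurableSet.univ, Measure.restrict_apply, Set.univ_inter,
      Real.volume_Ioo, one_mul]
    rw [← ENNReal.ofReal_coe_nnreal, ← ENNReal.ofReal_ofNat 2,
      ← ENNReal.ofReal_mul (by norm_num)]
    exact ENNReal.ofReal_le_ofReal (by linarith)
  | top => simp

theorem setLIntegral_lt_le_two_mul {α : Type*} [MeasurableSpace α] (μ : Measure α)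
    [SFinite μ] {s : ℝ} (hs : 0 < s) {F : α → ℝ≥0∞} (hF : Measurable F) :
    ∫⁻ x in {x | ENNReal.ofReal s < F x}, F x ∂μ ≤
      2 * ∫⁻ r in Set.Ioi (s / 2), μ {x | ENNReal.ofReal r < F x} := by
  rw [← lintegral_indicator (measurableSet_lt measurable_const hF)]
  calc _ ≤ ∫⁻ x, 2 * (∫⁻ r in Set.Ioi (s / 2), if ENNReal.ofReal r < F x then 1 else 0) ∂μ := by
        refine lintegral_mono fun x => ?_
        refine le_trans (le_of_eq ?_) (ite_lt_le_two_mul_lintegral hs (F x))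
        by_cases h : ENNReal.ofReal s < F x <;> simp [h]
    _ = _ := by
        rw [lintegral_const_mul' _ _ (by simp), lintegral_lintegral_swap]
        · congr 1
          refine lintegral_congr fun t => ?_
          have : ∀ x, (if ENNReal.ofReal t < F x then (1 : ℝ≥0∞) else 0) =
            {x | ENNReal.ofReal t < F x}.indicator 1 x := fun x => by simp [Set.indicator]
          simp_rw [this]
          exact lintegral_indicator_one (measurableSet_lt measurable_const hF)
        · exact (measurable_indicator_lt hF _ measurable_const).aemeasurable

/-! ### The one-dimensional maximal function over intervals with rational endpoints -/

theorem ofReal_mul_volume_biUnion_Ioo_le {F : ℝ → ℝ≥0∞} {s : ℝ} (hs : 0 < s) (T : Set (ℚ × ℚ))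
    (hT : ∀ q ∈ T, (q.1 : ℝ) < q.2 ∧
      ENNReal.ofReal s * ENNReal.ofReal (q.2 - q.1) ≤ ∫⁻ t in Set.Ioo (q.1 : ℝ) q.2, F t) :
    ENNReal.ofReal s * volume (⋃ q ∈ T, Set.Ioo (q.1 : ℝ) q.2) ≤ 4 * ∫⁻ t, F t := by
  by_cases hI : ∫⁻ t, F t = ⊤
  · simp [hI]
  have hball : ∀ q : ℚ × ℚ, Metric.ball (((q.1 : ℝ) + q.2) / 2) (((q.2 : ℝ) - q.1) / 2) =
      Set.Ioo (q.1 : ℝ) q.2 := fun q => by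
    rw [Real.ball_eq_Ioo]; congr 1 <;> ring
  -- Vitali covering, where any enlargement factor above 3 would do. The radii are bounded because
  -- the average over each interval is at least `s` and `F` is integrable.
  obtain ⟨u, huT, hdisj, hcov⟩ := Vitali.exists_disjoint_subfamily_covering_enlargement_ball T
    (fun q => ((q.1 : ℝ) + q.2) / 2) (fun q => ((q.2 : ℝ) - q.1) / 2)
    ((∫⁻ t, F t).toReal / s) (fun q hq => by
      have h := (hT q hq).2.trans (setLIntegral_le_lintegral _ _)
      rw [← ENNReal.ofReal_mul hs.le] at h
      have h2 := (ENNReal.ofReal_le_iff_le_toReal hI).1 h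
      rw [le_div_iff₀ hs]
      nlinarith [(hT q hq).1]) 4 (by norm_num)
  simp_rw [hball] at hcov hdisj
  have hsub : (⋃ q ∈ T, Set.Ioo (q.1 : ℝ) q.2) ⊆
      ⋃ q ∈ u, Metric.ball (((q.1 : ℝ) + q.2) / 2) (4 * (((q.2 : ℝ) - q.1) / 2)) := by
    refine Set.iUnion₂_subset fun q hq => ?_
    obtain ⟨b, hb, h⟩ := hcov q hq
    exact h.trans (Set.subset_biUnion_of_mem (u := fun q : ℚ × ℚ =>
      Metric.ball (((q.1 : ℝ) + q.2) / 2) (4 * (((q.2 : ℝ) - q.1) / 2))) hb)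
  calc _ ≤ ENNReal.ofReal s * ∑' q : u,
        volume (Metric.ball (((q.1.1 : ℝ) + q.1.2) / 2) (4 * (((q.1.2 : ℝ) - q.1.1) / 2))) := by
        gcongr
        exact (measure_mono hsub).trans (measure_biUnion_le volume u.to_countable _)
    _ = ∑' q : u, 4 * (ENNReal.ofReal s * ENNReal.ofReal ((q.1.2 : ℝ) - q.1.1)) := by
        rw [← ENNReal.tsum_mul_left]
        refine tsum_congr fun q => ?_
        rw [Real.volume_ball, show 2 * (4 * (((q.1.2 : ℝ) - q.1.1) / 2)) =
          4 * ((q.1.2 : ℝ) - q.1.1) by ring, ENNReal.ofReal_mul (by norm_num)]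
        rw [ENNReal.ofReal_ofNat]; ring
    _ ≤ ∑' q : u, 4 * ∫⁻ t in Set.Ioo (q.1.1 : ℝ) q.1.2, F t := by
        gcongr with q
        exact (hT q (huT q.2)).2
    _ = 4 * ∫⁻ t in ⋃ q ∈ u, Set.Ioo (q.1 : ℝ) q.2, F t := by
        rw [ENNReal.tsum_mul_left, lintegral_biUnion u.to_countable
          (fun _ _ => measurableSet_Ioo) hdisj]
    _ ≤ _ := by exact mul_le_mul_right (setLIntegral_le_lintegral _ _) 4

/-- The uncentred maximal function on the line, over intervals with rational endpoints. -/
def ratMaximal (F : ℝ → ℝ≥0∞) (x : ℝ) : ℝ≥0∞ :=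
  ⨆ q : ℚ × ℚ, (Set.Ioo (q.1 : ℝ) q.2).indicator
    (fun _ => (∫⁻ t in Set.Ioo (q.1 : ℝ) q.2, F t) / ENNReal.ofReal (q.2 - q.1)) x

theorem measurable_ratMaximal (F : ℝ → ℝ≥0∞) : Measurable (ratMaximal F) :=
  Measurable.iSup fun _ => measurable_const.indicator measurableSet_Ioo

/-- Values of `F` up to `s / 2` contribute at most `s / 2` to an average, so the part above `s / 2`
must supply the rest. This truncation of the weak type bound is what allows iteration. -/
theorem ofReal_mul_volume_lt_ratMaximal_le {F : ℝ → ℝ≥0∞} (hF : Measurable F) {s : ℝ}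
    (hs : 0 < s) :
    ENNReal.ofReal s * volume {x | ENNReal.ofReal s < ratMaximal F x} ≤
      8 * ∫⁻ t in {t | ENNReal.ofReal (s / 2) < F t}, F t := by
  set A := {t | ENNReal.ofReal (s / 2) < F t}
  have hA : MeasurableSet A := measurableSet_lt measurable_const hF
  set T : Set (ℚ × ℚ) := {q | (q.1 : ℝ) < q.2 ∧
    ENNReal.ofReal s * ENNReal.ofReal (q.2 - q.1) ≤ ∫⁻ t in Set.Ioo (q.1 : ℝ) q.2, F t}
  have hsub : {x | ENNReal.ofReal s < ratMaximal F x} ⊆ ⋃ q ∈ T, Set.Ioo (q.1 : ℝ) q.2 := by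
    intro x hx
    obtain ⟨q, hq⟩ := lt_iSup_iff.1 (show _ < ratMaximal F x from hx)
    have hxq : x ∈ Set.Ioo (q.1 : ℝ) q.2 := by
      by_contra h
      simp [h] at hq
    rw [Set.indicator_of_mem hxq] at hq
    have hlt : (q.1 : ℝ) < q.2 := hxq.1.trans hxq.2
    refine Set.mem_biUnion (x := q) ⟨hlt, ?_⟩ hxq
    exact (ENNReal.mul_lt_of_lt_div hq).le
  have hT : ∀ q ∈ T, (q.1 : ℝ) < q.2 ∧
      ENNReal.ofReal (s / 2) * ENNReal.ofReal (q.2 - q.1) ≤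
        ∫⁻ t in Set.Ioo (q.1 : ℝ) q.2, A.indicator F t := by
    intro q hq
    refine ⟨hq.1, ?_⟩
    by_contra! h
    have h1 : ∫⁻ t in Set.Ioo (q.1 : ℝ) q.2, F t ≤
        ∫⁻ t in Set.Ioo (q.1 : ℝ) q.2, (A.indicator F t + ENNReal.ofReal (s / 2)) := by
      refine lintegral_mono fun t => ?_
      by_cases ht : t ∈ A
      · simp [ht]
      · simpa [ht] using not_lt.1 ht
    rw [lintegral_add_right _ measurable_const, setLIntegral_const, Real.volume_Ioo] at h1
    have h2 := (hq.2.trans h1).trans_lt (ENNReal.add_lt_add_right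
      (ENNReal.mul_ne_top ENNReal.ofReal_ne_top ENNReal.ofReal_ne_top) h)
    rw [← add_mul, ← ENNReal.ofReal_add (by positivity) (by positivity), add_halves] at h2
    exact lt_irrefl _ h2
  have := ofReal_mul_volume_biUnion_Ioo_le (half_pos hs) T hT
  rw [lintegral_indicator hA] at this
  calc _ ≤ ENNReal.ofReal s * volume (⋃ q ∈ T, Set.Ioo (q.1 : ℝ) q.2) := by gcongr
    _ = 2 * (ENNReal.ofReal (s / 2) * volume (⋃ q ∈ T, Set.Ioo (q.1 : ℝ) q.2)) := by
        rw [← mul_assoc, ← ENNReal.ofReal_ofNat 2, ← ENNReal.ofReal_mul (by norm_num)]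
        congr 2; ring
    _ ≤ 2 * (4 * ∫⁻ t in A, F t) := by gcongr
    _ = _ := by rw [← mul_assoc]; norm_num

/-! ### Maximal functions in a single coordinate -/

section Coordinate

variable {ι : Type*} [DecidableEq ι]

/-- The one-dimensional maximal function applied in the `i`-th variable. -/
def coordMaximal (i : ι) (F : (ι → ℝ) → ℝ≥0∞) (x : ι → ℝ) : ℝ≥0∞ :=
  ratMaximal (fun t => F (Function.update x i t)) (x i)

theorem measurable_coordMaximal (i : ι) {F : (ι → ℝ) → ℝ≥0∞} (hF : Measurable F) :
    Measurable (coordMaximal i F) := by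
  unfold coordMaximal ratMaximal
  refine Measurable.iSup fun q => ?_
  have h1 : Measurable fun x : ι → ℝ =>
      (∫⁻ t in Set.Ioo (q.1 : ℝ) q.2, F (Function.update x i t)) /
        ENNReal.ofReal (q.2 - q.1) := by
    refine Measurable.div_const ?_ _
    refine Measurable.lintegral_prod_right'
      (f := fun z : (ι → ℝ) × ℝ => F (Function.update z.1 i z.2)) (hF.comp ?_)
    exact measurable_update'
  exact h1.indicator (measurableSet_Ioo.preimage (measurable_pi_apply i))

theorem ofReal_mul_volume_lt_coordMaximal_le [Fintype ι] (i : ι) {F : (ι → ℝ) → ℝ≥0∞} (hF : Measurable F)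
    {s : ℝ} (hs : 0 < s) :
    ENNReal.ofReal s * volume {x | ENNReal.ofReal s < coordMaximal i F x} ≤
      8 * ∫⁻ x in {x | ENNReal.ofReal (s / 2) < F x}, F x := by
  have hm := measurable_coordMaximal i hF
  have hS : MeasurableSet {x | ENNReal.ofReal s < coordMaximal i F x} :=
    measurableSet_lt measurable_const hm
  have hA : MeasurableSet {x | ENNReal.ofReal (s / 2) < F x} :=
    measurableSet_lt measurable_const hF
  rw [← lintegral_indicator_one hS, ← lintegral_indicator hA,
    ← lintegral_const_mul _ (measurable_one.indicator hS),
    ← lintegral_const_mul _ (hF.indicator hA)]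
  -- Fubini: the inequality holds on each line parallel to the `i`-th axis.
  refine lintegral_le_of_lmarginal_le {i} ((measurable_one.indicator hS).const_mul _)
    ((hF.indicator hA).const_mul _) fun x => ?_
  have hup : Measurable fun t => F (Function.update x i t) := hF.comp (measurable_update x)
  have h := ofReal_mul_volume_lt_ratMaximal_le hup hs
  have hB : MeasurableSet {t | ENNReal.ofReal (s / 2) < F (Function.update x i t)} :=
    measurableSet_lt measurable_const hup
  have hD : MeasurableSet {t | ENNReal.ofReal s <
      ratMaximal (fun t => F (Function.update x i t)) t} :=
    measurableSet_lt measurable_const (measurable_ratMaximal _)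
  rw [← lintegral_indicator_one hD, ← lintegral_indicator hB,
    ← lintegral_const_mul _ (hup.indicator hB),
    ← lintegral_const_mul _ (measurable_one.indicator hD)] at h
  rw [lmarginal_singleton, lmarginal_singleton]
  refine le_trans (le_of_eq ?_) (h.trans (le_of_eq ?_))
  · refine lintegral_congr fun t => ?_
    simp [Set.indicator, coordMaximal]
  · refine lintegral_congr fun t => ?_
    simp [Set.indicator]

end Coordinate

/-! ### The weak type inequality of Jessen, Marcinkiewicz and Zygmund -/

/-- `y [log (e + y)]^m` as an element of `[0,∞]`. -/
def logKernel (m : ℕ) (y : ℝ) : ℝ≥0∞ :=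
  ENNReal.ofReal (y * Real.log (Real.exp 1 + y) ^ m)

theorem measurable_logKernel (m : ℕ) : Measurable (logKernel m) := by
  unfold logKernel; fun_prop

theorem one_le_log_exp_one_add {y : ℝ} (hy : 0 ≤ y) : 1 ≤ Real.log (Real.exp 1 + y) := by
  rw [Real.le_log_iff_exp_le (by positivity)]; linarith

theorem log_exp_one_add_four_mul_le {y : ℝ} (hy : 0 ≤ y) :
    Real.log (Real.exp 1 + 4 * y) ≤ 3 * Real.log (Real.exp 1 + y) := by
  have h4 : Real.log 4 ≤ 2 := by
    rw [Real.log_le_iff_le_exp (by norm_num)]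
    have := Real.add_one_le_exp (1 : ℝ)
    rw [show (2 : ℝ) = 1 + 1 by norm_num, Real.exp_add]
    nlinarith
  have := one_le_log_exp_one_add hy
  have h5 : Real.log (Real.exp 1 + 4 * y) ≤ Real.log (4 * (Real.exp 1 + y)) :=
    Real.log_le_log (by positivity) (by nlinarith [Real.exp_pos 1])
  rw [Real.log_mul (by norm_num) (by positivity)] at h5
  linarith

/-- The extra logarithm is `∫ dr / r = log (4 h / (δ s))` over `s / 4 < r < h / δ`, a range that is
nonempty exactly when `δ / 4 * s < h`. The other logarithms are bounded by their value at `r = s /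
4`, at the cost of `3 ^ m`. -/
theorem setLIntegral_logKernel_div_le (m : ℕ) {δ : ℝ} (hδ : 0 < δ) {s h : ℝ} (hs : 0 < s)
    (hh : 0 ≤ h) :
    ∫⁻ r in Set.Ioi (s / 4), (if δ * r < h then logKernel m (h / r) else 0) ≤
      ENNReal.ofReal (3 ^ m * (1 + |Real.log (4 / δ)|)) * (ENNReal.ofReal s *
        if δ / 4 * s < h then logKernel (m + 1) (h / s) else 0) := by
  by_cases hc : δ / 4 * s < h
  swap
  · have : ∀ r ∈ Set.Ioi (s / 4), (if δ * r < h then logKernel m (h / r) else 0) = 0 := by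
      intro r hr
      have hr' : s / 4 < r := hr
      rw [if_neg]
      nlinarith
    rw [setLIntegral_congr_fun measurableSet_Ioi this]
    simp
  rw [if_pos hc]
  have hh0 : 0 < h := lt_trans (by positivity) hc
  set y := h / s with hy
  have hy0 : 0 < y := by positivity
  have hlt : s / 4 < h / δ := by rw [lt_div_iff₀ hδ]; linarith
  have h1 : ∀ r ∈ Set.Ioi (s / 4), (if δ * r < h then logKernel m (h / r) else 0) ≤
      (Set.Iio (h / δ)).indicator (fun r => ENNReal.ofReal
        (h * Real.log (Real.exp 1 + 4 * y) ^ m * r⁻¹)) r := by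
    intro r hr
    have hr' : s / 4 < r := hr
    have hr0 : 0 < r := lt_trans (by positivity) hr'
    split_ifs with h2
    swap
    · exact zero_le
    rw [Set.indicator_of_mem (by rw [Set.mem_Iio, lt_div_iff₀ hδ]; linarith)]
    unfold logKernel
    refine ENNReal.ofReal_le_ofReal ?_
    have h3 : h / r ≤ 4 * y := by
      rw [hy, div_le_iff₀ hr0]
      have : 4 * (h / s) * r = h * (4 * r / s) := by ring
      rw [this]
      have : 1 ≤ 4 * r / s := by rw [le_div_iff₀ hs]; linarith
      nlinarith
    have h4 : Real.log (Real.exp 1 + h / r) ≤ Real.log (Real.exp 1 + 4 * y) :=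
      Real.log_le_log (by positivity) (by linarith)
    have h5 := one_le_log_exp_one_add (y := h / r) (by positivity)
    calc h / r * Real.log (Real.exp 1 + h / r) ^ m
        ≤ h / r * Real.log (Real.exp 1 + 4 * y) ^ m := by gcongr
      _ = _ := by ring
  refine (setLIntegral_mono' measurableSet_Ioi h1).trans ?_
  rw [lintegral_indicator measurableSet_Iio, Measure.restrict_restrict measurableSet_Iio,
    Set.inter_comm, Set.Ioi_inter_Iio, restrict_Ioo_eq_restrict_Ioc]
  have hL4 := one_le_log_exp_one_add (y := 4 * y) (by positivity)
  have hL := one_le_log_exp_one_add (y := y) (by positivity)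
  have hII : IntervalIntegrable (fun r : ℝ => h * Real.log (Real.exp 1 + 4 * y) ^ m * r⁻¹)
      volume (s / 4) (h / δ) := by
    refine IntervalIntegrable.const_mul ?_ _
    refine intervalIntegral.intervalIntegrable_inv (fun r hr => ?_) continuousOn_id
    rw [Set.uIcc_of_le hlt.le] at hr
    exact (lt_of_lt_of_le (by positivity) hr.1).ne'
  rw [← ofReal_integral_eq_lintegral_ofReal
      ((intervalIntegrable_iff_integrableOn_Ioc_of_le hlt.le).1 hII)
      ((ae_restrict_iff' measurableSet_Ioc).2 (Filter.Eventually.of_forall fun r hr => by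
        have : 0 < r := lt_trans (by positivity) hr.1
        simp only [Pi.zero_apply]
        positivity)),
    ← intervalIntegral.integral_of_le hlt.le, intervalIntegral.integral_const_mul,
    integral_inv_of_pos (by positivity) (by positivity)]
  unfold logKernel
  rw [← ENNReal.ofReal_mul hs.le, ← ENNReal.ofReal_mul (by positivity)]
  refine ENNReal.ofReal_le_ofReal ?_
  have e1 : h / δ / (s / 4) = 4 / δ * y := by rw [hy]; field_simp
  have e2 : Real.log (h / δ / (s / 4)) ≤
      (1 + |Real.log (4 / δ)|) * Real.log (Real.exp 1 + y) := by
    rw [e1, Real.log_mul (by positivity) hy0.ne']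
    have := Real.log_le_log hy0 (by linarith [Real.exp_pos 1] : y ≤ Real.exp 1 + y)
    nlinarith [le_abs_self (Real.log (4 / δ)), abs_nonneg (Real.log (4 / δ))]
  have e3 := log_exp_one_add_four_mul_le hy0.le
  calc _ ≤ h * (3 * Real.log (Real.exp 1 + y)) ^ m *
        ((1 + |Real.log (4 / δ)|) * Real.log (Real.exp 1 + y)) := by
        gcongr
        exact Real.log_nonneg ((one_le_div (by positivity)).2 hlt.le)
    _ = 3 ^ m * (1 + |Real.log (4 / δ)|) * ((s * y) * Real.log (Real.exp 1 + y) ^ (m + 1)) := by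
        rw [show s * y = h by rw [hy]; field_simp]; ring
    _ = _ := by ring

/-- Composing with an operator of weak type `(1,1)` costs one logarithm. -/
theorem exists_meas_lt_le_logKernel_succ {α : Type*} [MeasurableSpace α] (μ : Measure α)
    [SFinite μ] (A B : ℝ≥0) (m : ℕ) {δ : ℝ} (hδ : 0 < δ) :
    ∃ B' : ℝ≥0, ∀ (h : α → ℝ≥0) (F G : α → ℝ≥0∞), Measurable h → Measurable F →
      (∀ s : ℝ, 0 < s → ENNReal.ofReal s * μ {x | ENNReal.ofReal s < G x} ≤
        A * ∫⁻ x in {x | ENNReal.ofReal (s / 2) < F x}, F x ∂μ) →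
      (∀ s : ℝ, 0 < s → μ {x | ENNReal.ofReal s < F x} ≤
        B * ∫⁻ x, (if δ * s < h x then logKernel m (h x / s) else 0) ∂μ) →
      ∀ s : ℝ, 0 < s → μ {x | ENNReal.ofReal s < G x} ≤
        B' * ∫⁻ x, (if δ / 4 * s < h x then logKernel (m + 1) (h x / s) else 0) ∂μ := by
  set D : ℝ := 3 ^ m * (1 + |Real.log (4 / δ)|)
  refine ⟨A * (2 * (B * D.toNNReal)), fun h F G hh hF hG hw s hs => ?_⟩
  have hmeas : Measurable fun q : α × ℝ =>
      (if δ * q.2 < h q.1 then logKernel m (h q.1 / q.2) else 0) := by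
    refine Measurable.ite (measurableSet_lt (by fun_prop) (by fun_prop)) ?_ measurable_const
    exact (measurable_logKernel m).comp (by fun_prop)
  have h1 : ENNReal.ofReal s * μ {x | ENNReal.ofReal s < G x} ≤ ENNReal.ofReal s *
      ((A * (2 * (B * D.toNNReal)) : ℝ≥0) *
        ∫⁻ x, (if δ / 4 * s < h x then logKernel (m + 1) (h x / s) else 0) ∂μ) := by
    -- The weak type bound truncates `F` at `s / 2`; the layer-cake bound halves this again, and the
    -- level sets of `F` above `s / 4` are controlled by the previous endpoint estimate.
    calc _ ≤ A * ∫⁻ x in {x | ENNReal.ofReal (s / 2) < F x}, F x ∂μ := hG s hs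
      _ ≤ A * (2 * ∫⁻ r in Set.Ioi (s / 2 / 2), μ {x | ENNReal.ofReal r < F x}) := by
          gcongr
          exact setLIntegral_lt_le_two_mul μ (half_pos hs) hF
      _ ≤ A * (2 * ∫⁻ r in Set.Ioi (s / 2 / 2), B *
            ∫⁻ x, (if δ * r < h x then logKernel m (h x / r) else 0) ∂μ) := by
          gcongr 2
          exact setLIntegral_mono' measurableSet_Ioi fun r hr =>
            hw r (lt_trans (by positivity) hr)
      _ = A * (2 * (B * ∫⁻ x, (∫⁻ r in Set.Ioi (s / 4),
            (if δ * r < h x then logKernel m (h x / r) else 0)) ∂μ)) := by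
          rw [lintegral_const_mul' _ _ (by simp), lintegral_lintegral_swap,
            show s / 2 / 2 = s / 4 by ring]
          exact (hmeas.comp measurable_swap).aemeasurable
      _ ≤ A * (2 * (B * ∫⁻ x, ENNReal.ofReal D * (ENNReal.ofReal s *
            if δ / 4 * s < h x then logKernel (m + 1) (h x / s) else 0) ∂μ)) := by
          gcongr 3
          refine lintegral_mono fun x => ?_
          exact setLIntegral_logKernel_div_le m hδ hs (h x).coe_nonneg
      _ = _ := by
          rw [lintegral_const_mul' _ _ (by simp), lintegral_const_mul' _ _ (by simp)]
          push_cast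
          rw [ENNReal.ofReal]
          ring
  exact (ENNReal.mul_le_mul_iff_right (by simpa using hs) ENNReal.ofReal_ne_top).1 h1

/-! ### Iteration over the coordinates -/

section Strong

variable {ι : Type*} [Fintype ι] [DecidableEq ι]

theorem setLIntegral_Ioo_le_ratMaximal (F : ℝ → ℝ≥0∞) (a b : ℚ) {x : ℝ}
    (hx : x ∈ Set.Ioo (a : ℝ) b) :
    ∫⁻ t in Set.Ioo (a : ℝ) b, F t ≤ ENNReal.ofReal (b - a) * ratMaximal F x := by
  have hab : (a : ℝ) < b := hx.1.trans hx.2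
  have : (∫⁻ t in Set.Ioo (a : ℝ) b, F t) / ENNReal.ofReal (b - a) ≤ ratMaximal F x := by
    refine le_trans (le_of_eq ?_) (le_iSup _ ((a, b) : ℚ × ℚ))
    simp only
    rw [Set.indicator_of_mem hx]
  rw [mul_comm]
  exact (ENNReal.div_le_iff (by simpa using hab) ENNReal.ofReal_ne_top).1 this

/-- Iterated coordinate maximal functions dominate averages over rectangles and satisfy the
endpoint estimate with one logarithm for each variable after the first. -/
theorem exists_iterated_maximal (s : Finset ι) (hs : s.Nonempty) :
    ∃ (C : ℝ≥0) (δ : ℝ), 0 < δ ∧ ∀ h : (ι → ℝ) → ℝ≥0, Measurable h →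
      ∃ G : (ι → ℝ) → ℝ≥0∞, Measurable G ∧
        (∀ (a b : ι → ℚ) (x : ι → ℝ), (∀ i ∈ s, x i ∈ Set.Ioo (a i : ℝ) (b i)) →
          (∫⋯∫⁻_s, (fun x => (h x : ℝ≥0∞))
            ∂(fun i => volume.restrict (Set.Ioo (a i : ℝ) (b i)))) x ≤
              (∏ i ∈ s, ENNReal.ofReal (b i - a i)) * G x) ∧
        ∀ r : ℝ, 0 < r → volume {x | ENNReal.ofReal r < G x} ≤
          C * ∫⁻ x, (if δ * r < h x then logKernel (s.card - 1) (h x / r) else 0) := by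
  induction hs using Finset.Nonempty.cons_induction with
  | singleton i =>
    refine ⟨8, 1 / 2, by norm_num, fun h hh => ⟨coordMaximal i (fun x => (h x : ℝ≥0∞)),
      measurable_coordMaximal i hh.coe_nnreal_ennreal, fun a b x hx => ?_, fun r hr => ?_⟩⟩
    · rw [lmarginal_singleton, Finset.prod_singleton]
      exact setLIntegral_Ioo_le_ratMaximal _ (a i) (b i) (hx i (by simp))
    · have h1 := ofReal_mul_volume_lt_coordMaximal_le i hh.coe_nnreal_ennreal hr
      refine (ENNReal.mul_le_mul_iff_right (a := ENNReal.ofReal r) (by simpa using hr)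
        ENNReal.ofReal_ne_top).1 (h1.trans (le_of_eq ?_))
      rw [mul_left_comm, ← lintegral_const_mul' _ _ ENNReal.ofReal_ne_top,
        ← lintegral_indicator (measurableSet_lt measurable_const hh.coe_nnreal_ennreal)]
      congr 1
      refine lintegral_congr fun x => ?_
      have hiff : ENNReal.ofReal (r / 2) < h x ↔ 1 / 2 * r < h x := by
        rw [← ENNReal.ofReal_coe_nnreal, ENNReal.ofReal_lt_ofReal_iff_of_nonneg (by positivity),
          one_div_mul_eq_div]
      by_cases hx : 1 / 2 * r < h x
      · rw [Set.indicator_of_mem (show x ∈ {a | ENNReal.ofReal (r / 2) < (h a : ℝ≥0∞)} from hiff.2 hx), if_pos hx]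
        simp only [logKernel, Finset.card_singleton, Nat.sub_self, pow_zero, mul_one]
        rw [← ENNReal.ofReal_mul hr.le, mul_div_cancel₀ _ hr.ne', ENNReal.ofReal_coe_nnreal]
      · rw [Set.indicator_of_notMem (show x ∉ {a | ENNReal.ofReal (r / 2) < (h a : ℝ≥0∞)} from
          fun h' => hx (hiff.1 h')), if_neg hx, mul_zero]
  | cons i s hi hs ih =>
    obtain ⟨C, δ, hδ, H⟩ := ih
    obtain ⟨B', hB'⟩ := exists_meas_lt_le_logKernel_succ (volume : Measure (ι → ℝ)) 8 C
      (s.card - 1) hδ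
    refine ⟨B', δ / 4, by positivity, fun h hh => ?_⟩
    obtain ⟨F, hF, hdom, hw⟩ := H h hh
    refine ⟨coordMaximal i F, measurable_coordMaximal i hF, fun a b x hx => ?_, ?_⟩
    · rw [Finset.cons_eq_insert, lmarginal_insert _ hh.coe_nnreal_ennreal hi,
        Finset.prod_insert hi]
      calc _ ≤ ∫⁻ t in Set.Ioo (a i : ℝ) (b i), (∏ j ∈ s, ENNReal.ofReal (b j - a j)) *
            F (Function.update x i t) := by
            refine lintegral_mono fun t => hdom a b _ fun j hj => ?_
            rw [Function.update_of_ne (by rintro rfl; exact hi hj)]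
            exact hx j (by simp [hj])
        _ = (∏ j ∈ s, ENNReal.ofReal (b j - a j)) *
            ∫⁻ t in Set.Ioo (a i : ℝ) (b i), F (Function.update x i t) :=
            lintegral_const_mul' _ _ (ENNReal.prod_ne_top fun _ _ => ENNReal.ofReal_ne_top)
        _ ≤ (∏ j ∈ s, ENNReal.ofReal (b j - a j)) *
            (ENNReal.ofReal (b i - a i) * coordMaximal i F x) := by
            gcongr
            exact setLIntegral_Ioo_le_ratMaximal _ (a i) (b i) (hx i (by simp))
        _ = _ := by ring
    · have hcard : (Finset.cons i s hi).card - 1 = s.card - 1 + 1 := by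
        rw [Finset.card_cons]
        have := hs.card_pos
        omega
      rw [hcard]
      exact hB' h F _ hh hF (fun r hr => ofReal_mul_volume_lt_coordMaximal_le i hF hr) hw

end Strong

/-- The open rectangle with lower corner `a` and upper corner `b`. -/
def box {n : ℕ} (a b : Fin n → ℝ) : Set (Fin n → ℝ) := Set.univ.pi fun i => Set.Ioo (a i) (b i)

/-- Rational rectangles, indexed by their corners. -/
def ratBox {n : ℕ} (q : (Fin n → ℚ) × (Fin n → ℚ)) : Set (Fin n → ℝ) :=
  box (fun i => (q.1 i : ℝ)) (fun i => (q.2 i : ℝ))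

theorem volume_box {n : ℕ} (a b : Fin n → ℝ) :
    volume (box a b) = ∏ i, ENNReal.ofReal (b i - a i) := by
  simp [box, volume_pi_pi]

/-- The iterated maximal function `G` exceeds 1 on every box where the average of `h` does. Level 1
is enough, since the height `t` enters later through `h = ψ(g / t)`. -/
theorem exists_volume_iUnion_ratBox_le {n : ℕ} (hn : 1 ≤ n) :
    ∃ (C : ℝ≥0) (δ : ℝ), 0 < δ ∧ ∀ h : (Fin n → ℝ) → ℝ≥0, Measurable h →
      volume (⋃ q ∈ {q : (Fin n → ℚ) × (Fin n → ℚ) |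
          volume (ratBox q) < ∫⁻ x in ratBox q, (h x : ℝ≥0∞)}, ratBox q) ≤
        C * ∫⁻ x, (if δ < h x then logKernel (n - 1) (h x) else 0) := by
  have : Nonempty (Fin n) := ⟨⟨0, hn⟩⟩
  obtain ⟨C, δ, hδ, H⟩ := exists_iterated_maximal (Finset.univ : Finset (Fin n))
    Finset.univ_nonempty
  refine ⟨C, δ, hδ, fun h hh => ?_⟩
  obtain ⟨G, -, hdom, hw⟩ := H h hh
  have h1 := hw 1 one_pos
  simp only [mul_one, div_one, Finset.card_univ, Fintype.card_fin, ENNReal.ofReal_one] at h1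
  refine le_trans (measure_mono ?_) h1
  refine Set.iUnion₂_subset fun q hq x hx => ?_
  have h2 := hdom q.1 q.2 x fun i _ => hx i (Set.mem_univ i)
  rw [lmarginal_univ, ← Measure.restrict_pi_pi] at h2
  have h3 := (show _ < _ from hq).trans_le h2
  rw [ratBox, volume_box] at h3
  by_contra hle
  have hle' : G x ≤ 1 := not_lt.1 hle
  exact absurd h3 (not_lt.2 (mul_le_of_le_one_right' hle'))

/-! ### Greedy selection of scattered sets -/

/-- Greedy choice in order of decreasing `a`: a set is kept unless more than the fraction `l` of it
is already covered, and `E` records the newly covered part. A rejected set is covered by sets with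
values of `a` no smaller; a kept one covers itself, and `l < 1` makes the inequality strict. -/
theorem exists_scattered_subfamily {α κ : Type*} [MeasurableSpace α] [DecidableEq κ]
    (μ : Measure α) (R : κ → Set α) (hR : ∀ i, MeasurableSet (R i))
    (h0 : ∀ i, μ (R i) ≠ 0) (htop : ∀ i, μ (R i) ≠ ⊤) (a : κ → ℝ≥0∞) {l : ℝ} (hl0 : 0 < l)
    (hl1 : l < 1) (J : Finset κ) :
    ∃ S ⊆ J, ∃ E : κ → Set α,
      (∀ i ∈ S, MeasurableSet (E i) ∧ E i ⊆ R i ∧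
        ENNReal.ofReal (1 - l) * μ (R i) ≤ μ (E i)) ∧
      (S : Set κ).PairwiseDisjoint E ∧
      ∀ j ∈ J, ENNReal.ofReal l * μ (R j) < μ (R j ∩ ⋃ i ∈ {i | i ∈ S ∧ a j ≤ a i}, R i) := by
  induction J using Finset.induction_on_min_value a with
  | empty => exact ⟨∅, by simp, fun _ => ∅, by simp, by simp, by simp⟩
  | insert j J hj hmin ih =>
    obtain ⟨S, hSJ, E, hE, hdisj, hcov⟩ := ih
    set U := ⋃ i ∈ S, R i
    have hUm : MeasurableSet U := S.measurableSet_biUnion fun i _ => hR i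
    by_cases hc : ENNReal.ofReal l * μ (R j) < μ (R j ∩ U)
    · refine ⟨S, hSJ.trans (Finset.subset_insert _ _), E, hE, hdisj, fun k hk => ?_⟩
      rcases Finset.mem_insert.1 hk with rfl | hk
      · exact hc.trans_le (measure_mono (Set.inter_subset_inter_right _
          (Set.biUnion_subset_biUnion_left fun i hi => ⟨hi, hmin i (hSJ hi)⟩)))
      · exact hcov k hk
    · have hjS : j ∉ S := fun h => hj (hSJ h)
      have hupd : ∀ i ∈ S, Function.update E j (R j \ U) i = E i := fun i hi =>
        Function.update_of_ne (by rintro rfl; exact hjS hi) _ _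
      refine ⟨insert j S, Finset.insert_subset_insert _ hSJ, Function.update E j (R j \ U),
        fun i hi => ?_, ?_, fun k hk => ?_⟩
      · rcases Finset.mem_insert.1 hi with rfl | hi
        · rw [Function.update_self]
          refine ⟨(hR i).diff hUm, Set.sdiff_subset, ?_⟩
          have h1 : μ (R i) = μ (R i ∩ U) + μ (R i \ U) := (measure_inter_add_sdiff _ hUm).symm
          have h2 : μ (R i) = ENNReal.ofReal l * μ (R i) + ENNReal.ofReal (1 - l) * μ (R i) := by
            rw [← add_mul, ← ENNReal.ofReal_add hl0.le (by linarith)]; simp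
          have h3 : ENNReal.ofReal l * μ (R i) + ENNReal.ofReal (1 - l) * μ (R i) ≤
              ENNReal.ofReal l * μ (R i) + μ (R i \ U) := by
            rw [← h2]
            nth_rw 1 [h1]
            gcongr
            exact not_lt.1 hc
          exact (ENNReal.add_le_add_iff_left
            (ENNReal.mul_ne_top ENNReal.ofReal_ne_top (htop i))).1 h3
        · rw [hupd i hi]
          exact hE i hi
      · rw [Finset.coe_insert, Set.pairwiseDisjoint_insert]
        refine ⟨fun i hi k hk hik => ?_, fun i hi _ => ?_⟩
        · simp only [Function.onFun]
          rw [hupd i hi, hupd k hk]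
          exact hdisj hi hk hik
        · rw [Function.update_self, hupd i hi]
          exact Set.disjoint_sdiff_left.mono_right
            ((hE i hi).2.1.trans (Set.subset_biUnion_of_mem (u := R) hi))
      · rcases Finset.mem_insert.1 hk with rfl | hk
        · rw [Set.inter_eq_left.2
            (Set.subset_biUnion_of_mem (u := R) (show k ∈ {i | i ∈ insert k S ∧ a k ≤ a i} from
              ⟨Finset.mem_insert_self _ _, le_rfl⟩))]
          calc _ < 1 * μ (R k) :=
                (ENNReal.mul_lt_mul_iff_left (h0 k) (htop k)).2 (by simpa using hl1)
            _ = _ := one_mul _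
        · refine (hcov k hk).trans_le (measure_mono (Set.inter_subset_inter_right _ ?_))
          exact Set.biUnion_subset_biUnion_left fun i hi =>
            ⟨Finset.mem_insert_of_mem hi.1, hi.2⟩

/-! ### The complementary function -/

theorem complementary_mono (Φ : ℝ≥0 → ℝ≥0) : Monotone (complementary Φ) := by
  intro s s' h
  unfold complementary
  gcongr

theorem mul_le_complementary_add (Φ : ℝ≥0 → ℝ≥0) (s t : ℝ≥0) :
    (s * t : ℝ≥0∞) ≤ complementary Φ s + Φ t := by
  rcases eq_or_ne t 0 with rfl | ht
  · simp
  · exact tsub_le_iff_right.1 (le_iSup₂_of_le (f := fun (t : ℝ≥0) (_ : 0 < t) =>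
      ((s : ℝ≥0∞) * t - Φ t)) t (pos_iff_ne_zero.2 ht) le_rfl)

theorem complementary_mul_le (Φ : ℝ≥0 → ℝ≥0) {θ : ℝ≥0} (hθ : θ ≤ 1) (s : ℝ≥0) :
    complementary Φ (θ * s) ≤ θ * complementary Φ s := by
  refine iSup₂_le fun t ht => ?_
  calc _ ≤ ((θ * (s * t) : ℝ≥0∞) - θ * Φ t) := by
        rw [ENNReal.coe_mul, mul_assoc]
        gcongr
        exact mul_le_of_le_one_left' (by exact_mod_cast hθ)
    _ = θ * ((s * t : ℝ≥0∞) - Φ t) := (ENNReal.mul_sub (by simp)).symm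
    _ ≤ _ := by
        gcongr
        exact le_iSup₂_of_le (f := fun (t : ℝ≥0) (_ : 0 < t) =>
          ((s : ℝ≥0∞) * t - Φ t)) t ht le_rfl

theorem logBump_coe (n : ℕ) (y : ℝ≥0) : logBump n y = logKernel (n - 1) y := by
  have := one_le_log_exp_one_add y.coe_nonneg
  rw [logBump, logKernel, ENNReal.ofReal_mul y.coe_nonneg, ENNReal.ofReal_coe_nnreal,
    ENNReal.ofReal_pow (by linarith), ENNReal.coe_toReal]

theorem logBump_top (n : ℕ) : logBump n ⊤ = ⊤ := by
  simp [logBump]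

theorem logKernel_mono (m : ℕ) {y z : ℝ} (hy : 0 ≤ y) (hyz : y ≤ z) :
    logKernel m y ≤ logKernel m z := by
  unfold logKernel
  have := one_le_log_exp_one_add hy
  have := hy.trans hyz
  gcongr

/-- An infinite value would persist on a half-line by monotonicity and make the integral infinite.
-/
theorem StrongBp.ne_top {n : ℕ} {p : ℝ} {Ψ : ℝ≥0 → ℝ≥0∞} (hΨ : Monotone Ψ)
    (h : StrongBp n p Ψ) (s : ℝ≥0) : Ψ s ≠ ⊤ := by
  intro hs
  obtain ⟨c, hc, h⟩ := h
  refine h.ne ?_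
  have h1 : ∀ t ∈ Set.Ioi (max c s), (⊤ : ℝ≥0∞) ≤
      logBump n (Ψ t.toNNReal) / ENNReal.ofReal (t ^ p) / ENNReal.ofReal t := by
    intro t ht
    have hst : s ≤ t.toNNReal := by
      rw [Real.le_toNNReal_iff_coe_le (hc.le.trans ((le_max_left _ _).trans (le_of_lt ht)))]
      exact (le_max_right _ _).trans (le_of_lt ht)
    have : Ψ t.toNNReal = ⊤ := eq_top_iff.2 (hs ▸ hΨ hst)
    rw [this, logBump_top, ENNReal.top_div_of_ne_top ENNReal.ofReal_ne_top,
      ENNReal.top_div_of_ne_top ENNReal.ofReal_ne_top]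
  refine eq_top_iff.2 (le_trans ?_
    (lintegral_mono_set (Set.Ioi_subset_Ioi (le_max_left c s))))
  refine le_trans ?_ (setLIntegral_mono' measurableSet_Ioi h1)
  simp

/-- The lower limit may be moved to any `b > 0`, because the integrand is bounded on `(b, c]` when
`ψ` is finite and monotone. -/
theorem StrongBp.lintegral_logKernel_lt_top {n : ℕ} {p : ℝ} (hp : 0 < p) {ψ : ℝ≥0 → ℝ≥0}
    (hψ : Monotone ψ) (h : StrongBp n p fun s => (ψ s : ℝ≥0∞)) {b : ℝ} (hb : 0 < b) :
    ∫⁻ r in Set.Ioi b, logKernel (n - 1) (ψ r.toNNReal) * ENNReal.ofReal (p * r ^ (-p - 1)) < ⊤ := by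
  obtain ⟨c, hc, h⟩ := h
  have hsub : Set.Ioi b ⊆ Set.Ioc b c ∪ Set.Ioi c := fun x hx => by
    rcases le_or_gt x c with h | h
    · exact Or.inl ⟨hx, h⟩
    · exact Or.inr h
  refine (lintegral_mono_set hsub).trans_lt ((lintegral_union_le _ _ _).trans_lt
    (ENNReal.add_lt_top.2 ⟨?_, ?_⟩))
  · have h1 : ∀ r ∈ Set.Ioc b c, logKernel (n - 1) (ψ r.toNNReal) *
        ENNReal.ofReal (p * r ^ (-p - 1)) ≤
        logKernel (n - 1) (ψ c.toNNReal) * ENNReal.ofReal (p * b ^ (-p - 1)) := by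
      intro r hr
      refine mul_le_mul' (logKernel_mono _ (NNReal.coe_nonneg _)
        (NNReal.coe_le_coe.2 (hψ (Real.toNNReal_le_toNNReal hr.2)))) ?_
      refine ENNReal.ofReal_le_ofReal (mul_le_mul_of_nonneg_left ?_ hp.le)
      exact Real.rpow_le_rpow_of_nonpos hb hr.1.le (by linarith)
    refine (setLIntegral_mono' measurableSet_Ioc h1).trans_lt ?_
    rw [setLIntegral_const]
    exact ENNReal.mul_lt_top (ENNReal.mul_lt_top ENNReal.ofReal_lt_top ENNReal.ofReal_lt_top)
      (by simp)
  · have h1 : ∀ r ∈ Set.Ioi c, logKernel (n - 1) (ψ r.toNNReal) *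
        ENNReal.ofReal (p * r ^ (-p - 1)) = ENNReal.ofReal p *
        (logBump n (ψ r.toNNReal) / ENNReal.ofReal (r ^ p) / ENNReal.ofReal r) := by
      intro r hr
      have hr0 : 0 < r := hc.trans hr
      rw [logBump_coe, ENNReal.ofReal_mul hp.le, Real.rpow_sub hr0, Real.rpow_one,
        Real.rpow_neg hr0.le, ENNReal.ofReal_div_of_pos hr0,
        ENNReal.ofReal_inv_of_pos (by positivity)]
      simp only [div_eq_mul_inv]
      ring
    rw [setLIntegral_congr_fun measurableSet_Ioi h1, lintegral_const_mul' _ _ (by simp)]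
    exact ENNReal.mul_lt_top ENNReal.ofReal_lt_top h

/-- The change of variables `t = a / r`. -/
theorem lintegral_comp_const_div {p a b : ℝ} (ha : 0 ≤ a) (hb : 0 < b) (hp : 0 < p)
    (H : ℝ → ℝ≥0∞) :
    ∫⁻ t in Set.Ioi 0, ENNReal.ofReal (p * t ^ (p - 1)) * (if b * t < a then H (a / t) else 0) =
      ENNReal.ofReal (a ^ p) *
        ∫⁻ r in Set.Ioi b, H r * ENNReal.ofReal (p * r ^ (-p - 1)) := by
  rcases ha.eq_or_lt with rfl | ha
  · rw [Real.zero_rpow hp.ne', ENNReal.ofReal_zero, zero_mul]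
    refine (setLIntegral_congr_fun measurableSet_Ioi fun t (ht : 0 < t) => ?_).trans
      lintegral_zero
    rw [if_neg (by nlinarith [mul_pos hb ht]), mul_zero]
  have himg : (fun r => a / r) '' Set.Ioi b = Set.Ioo 0 (a / b) := by
    ext t
    constructor
    · rintro ⟨r, hr, rfl⟩
      have hr' : b < r := hr
      exact ⟨div_pos ha (hb.trans hr'), div_lt_div_of_pos_left ha hb hr'⟩
    · rintro ⟨h1, h2⟩
      refine ⟨a / t, ?_, by field_simp⟩
      rw [Set.mem_Ioi, lt_div_iff₀ h1]
      rw [lt_div_iff₀ hb] at h2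
      linarith
  have h1 : ∀ t ∈ Set.Ioi (0 : ℝ), ENNReal.ofReal (p * t ^ (p - 1)) *
      (if b * t < a then H (a / t) else 0) =
      (Set.Iio (a / b)).indicator (fun t => ENNReal.ofReal (p * t ^ (p - 1)) * H (a / t)) t := by
    intro t ht
    have : b * t < a ↔ t < a / b := by rw [lt_div_iff₀ hb, mul_comm]
    simp [Set.indicator, this]
  rw [setLIntegral_congr_fun measurableSet_Ioi h1, lintegral_indicator measurableSet_Iio,
    Measure.restrict_restrict measurableSet_Iio, Set.inter_comm, Set.Ioi_inter_Iio, ← himg,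
    lintegral_image_eq_lintegral_abs_deriv_mul measurableSet_Ioi (f' := fun r => -a / r ^ 2)
      (fun r hr => ?_) (fun r hr r' hr' h => ?_), ← lintegral_const_mul' _ _ (by simp)]
  · refine setLIntegral_congr_fun measurableSet_Ioi fun r hr => ?_
    have hr0 : 0 < r := hb.trans hr
    rw [div_div_cancel₀ ha.ne', ← mul_assoc, ← ENNReal.ofReal_mul (abs_nonneg _), mul_comm (H r),
      ← mul_assoc (ENNReal.ofReal (a ^ p)), ← ENNReal.ofReal_mul (p := a ^ p) (by positivity)]
    congr 2
    rw [neg_div, abs_neg, abs_of_pos (by positivity), Real.div_rpow ha.le hr0.le,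
      Real.rpow_sub ha, Real.rpow_sub hr0, Real.rpow_sub hr0, Real.rpow_neg hr0.le,
      Real.rpow_one, Real.rpow_one]
    have : 0 < r ^ p := by positivity
    field_simp
  · have hr0 : 0 < r := hb.trans hr
    have h2 := ((hasDerivAt_const r a).div (hasDerivAt_id r) hr0.ne').hasDerivWithinAt
      (s := Set.Ioi b)
    simp only [id_eq, zero_mul, mul_one, zero_sub] at h2
    exact h2
  · have hr0 : 0 < r := hb.trans hr
    have hr0' : 0 < r' := hb.trans hr'
    field_simp at h
    linarith

/-- The strong type estimate for the Orlicz maximal function of `ψ`, in distributional form. -/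
theorem exists_lintegral_volume_iUnion_ratBox_le {n : ℕ} (hn : 1 ≤ n) {p : ℝ} (hp : 0 < p)
    {ψ : ℝ≥0 → ℝ≥0} (hψ : Monotone ψ) (hψ0 : ∀ ε : ℝ, 0 < ε → ∃ b : ℝ≥0, 0 < b ∧ ψ b ≤ ε)
    (h : StrongBp n p fun s => (ψ s : ℝ≥0∞)) :
    ∃ C : ℝ≥0, ∀ g : (Fin n → ℝ) → ℝ≥0, Measurable g →
      ∫⁻ t in Set.Ioi (0 : ℝ), ENNReal.ofReal (p * t ^ (p - 1)) *
        volume (⋃ q ∈ {q : (Fin n → ℚ) × (Fin n → ℚ) |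
          volume (ratBox q) < ∫⁻ x in ratBox q, (ψ (g x / t.toNNReal) : ℝ≥0∞)}, ratBox q) ≤
        C * ∫⁻ x, (g x : ℝ≥0∞) ^ p := by
  obtain ⟨C, δ, hδ, H⟩ := exists_volume_iUnion_ratBox_le hn
  -- With `ψ b ≤ δ`, the cutoff `ψ (g / t) > δ` forces `b * t < g`, so the integral in `r = g / t`
  -- stays away from zero.
  obtain ⟨b, hb, hbδ⟩ := hψ0 δ hδ
  have hI := h.lintegral_logKernel_lt_top hp hψ (NNReal.coe_pos.2 hb)
  set I := ∫⁻ r in Set.Ioi (b : ℝ), logKernel (n - 1) (ψ r.toNNReal) *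
    ENNReal.ofReal (p * r ^ (-p - 1))
  have hψm : Measurable ψ := hψ.measurable
  refine ⟨C * I.toNNReal, fun g hg => ?_⟩
  have hmeas : Measurable fun q : ℝ × (Fin n → ℝ) => ENNReal.ofReal (p * q.1 ^ (p - 1)) *
      (if b * q.1 < g q.2 then logKernel (n - 1) (ψ (g q.2 / q.1).toNNReal) else 0) := by
    refine Measurable.mul (by fun_prop) ?_
    refine Measurable.ite (measurableSet_lt (by fun_prop) (by fun_prop)) ?_ measurable_const
    refine (measurable_logKernel _).comp (measurable_coe_nnreal_real.comp (hψm.comp ?_))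
    fun_prop
  calc _ ≤ ∫⁻ t in Set.Ioi (0 : ℝ), C * ∫⁻ x, ENNReal.ofReal (p * t ^ (p - 1)) *
        (if b * t < g x then logKernel (n - 1) (ψ (g x / t).toNNReal) else 0) := by
        refine setLIntegral_mono' measurableSet_Ioi fun t ht => ?_
        have ht0 : 0 < t := ht
        rw [lintegral_const_mul' _ _ (by simp), mul_left_comm]
        gcongr
        refine (H (fun x => ψ (g x / t.toNNReal)) (hψm.comp (hg.div_const _))).trans ?_
        gcongr with x
        have e : g x / t.toNNReal = ((g x : ℝ) / t).toNNReal := by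
          rw [Real.toNNReal_div (NNReal.coe_nonneg _), Real.toNNReal_coe]
        rw [e]
        split_ifs with h1 h2
        · exact le_rfl
        · exfalso
          have h3 : ((g x : ℝ) / t).toNNReal ≤ b := by
            rw [Real.toNNReal_le_iff_le_coe, div_le_iff₀ ht0]
            exact not_lt.1 h2
          exact absurd h1 (not_lt.2 ((NNReal.coe_le_coe.2 (hψ h3)).trans hbδ))
        · exact zero_le
        · exact le_rfl
    _ = C * ∫⁻ x, (∫⁻ t in Set.Ioi (0 : ℝ), ENNReal.ofReal (p * t ^ (p - 1)) *
        (if b * t < g x then logKernel (n - 1) (ψ (g x / t).toNNReal) else 0)) := by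
        rw [lintegral_const_mul' _ _ (by simp), lintegral_lintegral_swap hmeas.aemeasurable]
    _ = C * ∫⁻ x, (g x : ℝ≥0∞) ^ p * I := by
        congr 1
        refine lintegral_congr fun x => ?_
        rw [lintegral_comp_const_div (g x).coe_nonneg (NNReal.coe_pos.2 hb) hp
          (fun r => logKernel (n - 1) (ψ r.toNNReal)),
          ← ENNReal.ofReal_rpow_of_nonneg (g x).coe_nonneg hp.le, ENNReal.ofReal_coe_nnreal]
    _ = _ := by
        rw [lintegral_mul_const' _ _ hI.ne, ENNReal.coe_mul, ENNReal.coe_toNNReal hI.ne]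
        ring

/-! ### Averages over rectangles -/

theorem measurableSet_box {n : ℕ} (a b : Fin n → ℝ) : MeasurableSet (box a b) :=
  MeasurableSet.univ_pi fun _ => measurableSet_Ioo

theorem volume_box_ne_zero {n : ℕ} {a b : Fin n → ℝ} (h : ∀ i, a i < b i) :
    volume (box a b) ≠ 0 := by
  rw [volume_box]
  exact Finset.prod_ne_zero_iff.2 fun i _ => by simpa using h i

theorem volume_box_ne_top {n : ℕ} (a b : Fin n → ℝ) : volume (box a b) ≠ ⊤ := by
  rw [volume_box]
  exact ENNReal.prod_ne_top fun _ _ => ENNReal.ofReal_ne_top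

theorem isRectangle_box {n : ℕ} {a b : Fin n → ℝ} (h : ∀ i, a i < b i) : IsRectangle (box a b) :=
  ⟨a, b, h, rfl⟩

/-- The rational boxes around `x` with corners strictly inside the box form a directed family
exhausting it. By monotone convergence one of them carries enough of the integral, and its smaller
volume only raises the average. -/
theorem exists_ratBox_of_lt_setLAverage {n : ℕ} {a b x : Fin n → ℝ} (hx : x ∈ box a b)
    {f : (Fin n → ℝ) → ℝ≥0∞} {c : ℝ≥0∞} (hc : c < ⨍⁻ y in box a b, f y ∂volume) :
    ∃ q : (Fin n → ℚ) × (Fin n → ℚ), x ∈ ratBox q ∧ c < ⨍⁻ y in ratBox q, f y ∂volume := by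
  have hab : ∀ i, a i < b i := fun i => (hx i trivial).1.trans (hx i trivial).2
  let I := {q : (Fin n → ℚ) × (Fin n → ℚ) //
    ∀ i, a i < q.1 i ∧ (q.1 i : ℝ) < x i ∧ x i < q.2 i ∧ (q.2 i : ℝ) < b i}
  have hU : box a b = ⋃ q : I, ratBox q.1 := by
    refine Set.Subset.antisymm (fun y hy => ?_) (Set.iUnion_subset fun q y hy i _ => ?_)
    · have h1 : ∀ i, ∃ r : ℚ, a i < r ∧ (r : ℝ) < min (x i) (y i) := fun i =>
        exists_rat_btwn (lt_min (hx i trivial).1 (hy i trivial).1)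
      have h2 : ∀ i, ∃ r : ℚ, max (x i) (y i) < r ∧ (r : ℝ) < b i := fun i =>
        exists_rat_btwn (max_lt (hx i trivial).2 (hy i trivial).2)
      choose r1 h1 h1' using h1
      choose r2 h2 h2' using h2
      refine Set.mem_iUnion.2 ⟨⟨(r1, r2), fun i => ⟨h1 i, (lt_min_iff.1 (h1' i)).1,
        (max_lt_iff.1 (h2 i)).1, h2' i⟩⟩, fun i _ => ⟨(lt_min_iff.1 (h1' i)).2,
        (max_lt_iff.1 (h2 i)).2⟩⟩
    · exact ⟨(q.2 i).1.trans (hy i trivial).1, (hy i trivial).2.trans (q.2 i).2.2.2⟩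
  have hdir : Directed (· ⊆ ·) fun q : I => ratBox q.1 := by
    intro q q'
    refine ⟨⟨(q.1.1 ⊓ q'.1.1, q.1.2 ⊔ q'.1.2), fun i => ?_⟩, fun y hy i _ => ?_, fun y hy i _ => ?_⟩
    · simp only [Pi.inf_apply, Pi.sup_apply, Rat.cast_min, Rat.cast_max]
      exact ⟨lt_min (q.2 i).1 (q'.2 i).1, min_lt_of_left_lt (q.2 i).2.1,
        lt_max_of_lt_left (q.2 i).2.2.1, max_lt (q.2 i).2.2.2 (q'.2 i).2.2.2⟩
    · simp only [Pi.inf_apply, Pi.sup_apply, Rat.cast_min, Rat.cast_max]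
      exact ⟨min_lt_of_left_lt (hy i trivial).1, lt_max_of_lt_left (hy i trivial).2⟩
    · simp only [Pi.inf_apply, Pi.sup_apply, Rat.cast_min, Rat.cast_max]
      exact ⟨min_lt_of_right_lt (hy i trivial).1, lt_max_of_lt_right (hy i trivial).2⟩
  rw [setLAverage_eq] at hc
  have h1 := ENNReal.mul_lt_of_lt_div hc
  nth_rw 2 [hU] at h1
  rw [setLIntegral_iUnion_of_directed _ hdir] at h1
  obtain ⟨q, hq⟩ := lt_iSup_iff.1 h1
  have hxq : x ∈ ratBox q.1 := fun i _ => ⟨(q.2 i).2.1, (q.2 i).2.2.1⟩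
  refine ⟨q.1, hxq, ?_⟩
  have hne : volume (ratBox q.1) ≠ 0 :=
    volume_box_ne_zero fun i => (hxq i trivial).1.trans (hxq i trivial).2
  rw [setLAverage_eq, ENNReal.lt_div_iff_mul_lt (Or.inl hne) (Or.inl (volume_box_ne_top _ _))]
  refine lt_of_le_of_lt ?_ hq
  gcongr
  rw [hU]
  exact Set.subset_iUnion (fun q : I => ratBox q.1) q

theorem strongMaximal_le_iSup_ratBox {n : ℕ} (f : (Fin n → ℝ) → ℝ) (x : Fin n → ℝ) :
    strongMaximal f x ≤ ⨆ q : {q : (Fin n → ℚ) × (Fin n → ℚ) // ∀ i, q.1 i < q.2 i},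
      (ratBox q.1).indicator (fun _ => ⨍⁻ y in ratBox q.1, ‖f y‖ₑ ∂volume) x := by
  refine iSup_le fun R => iSup₂_le fun hR hx => ?_
  obtain ⟨a, b, hab, rfl⟩ := hR
  refine le_of_forall_lt fun c hc => ?_
  obtain ⟨q, hxq, hq⟩ := exists_ratBox_of_lt_setLAverage (a := a) (b := b) hx hc
  refine hq.trans_le ?_
  refine le_trans (le_of_eq ?_) (le_iSup _ (⟨q, fun i => ?_⟩ :
    {q : (Fin n → ℚ) × (Fin n → ℚ) // ∀ i, q.1 i < q.2 i}))
  · simp only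
    rw [Set.indicator_of_mem hxq]
  · have := (hxq i trivial).1.trans (hxq i trivial).2
    exact Rat.cast_lt.1 this

/-! ### Generalised Hölder inequality and the bump condition -/

/-- Young's inequality at `s = v f / N` and `t = v⁻¹ / l`. Where `v = 0` the convention `Φ(∞) = ∞`
makes the right side infinite. -/
theorem coe_le_mul_complementary_add_extend (Φ : ℝ≥0 → ℝ≥0) (v f : ℝ≥0) {N l : ℝ≥0}
    (hN : 0 < N) (hl : 0 < l) :
    (f : ℝ≥0∞) ≤ l * N * (complementary Φ (v * f / N) + extend Φ ((v : ℝ≥0∞)⁻¹ / l)) := by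
  rcases eq_or_ne v 0 with rfl | hv
  · have : extend Φ (((0 : ℝ≥0) : ℝ≥0∞)⁻¹ / l) = ⊤ := by
      simp [extend, ENNReal.top_div_of_ne_top]
    rw [this, add_top, ENNReal.mul_top]
    · exact le_top
    · exact mul_ne_zero (by simpa using hl.ne') (by simpa using hN.ne')
  · have h1 : (v : ℝ≥0∞)⁻¹ / l = ((v⁻¹ / l : ℝ≥0) : ℝ≥0∞) := by
      rw [ENNReal.coe_div hl.ne', ENNReal.coe_inv hv]
    have h2 : extend Φ ((v : ℝ≥0∞)⁻¹ / l) = Φ (v⁻¹ / l) := by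
      rw [h1]; simp [extend]
    rw [h2]
    have h3 := mul_le_complementary_add Φ (v * f / N) (v⁻¹ / l)
    calc (f : ℝ≥0∞) = l * N * ((v * f / N : ℝ≥0) * (v⁻¹ / l : ℝ≥0)) := by
          norm_cast
          field_simp
      _ ≤ _ := by gcongr

theorem setLAverage_le_of_luxemburg {n : ℕ} (Φ : ℝ≥0 → ℝ≥0) {v f : (Fin n → ℝ) → ℝ≥0}
    (hv : Measurable v) (hf : Measurable f) {R : Set (Fin n → ℝ)}
    (hR : volume R ≠ 0) (hR' : volume R ≠ ⊤) {N : ℝ≥0} (hN : 0 < N)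
    (hadm : ∫⁻ x in R, complementary Φ (v x * f x / N) ≤ volume R) :
    ⨍⁻ x in R, (f x : ℝ≥0∞) ∂volume ≤ 2 * N * luxemburgNorm Φ R fun x => (v x : ℝ≥0∞)⁻¹ := by
  have h2N0 : (2 * N : ℝ≥0∞) ≠ 0 := mul_ne_zero two_ne_zero (by simpa using hN.ne')
  have h2Nt : (2 * N : ℝ≥0∞) ≠ ⊤ := ENNReal.mul_ne_top (by simp) (by simp)
  rw [mul_comm, ← ENNReal.div_le_iff h2N0 h2Nt]
  refine le_iInf fun l => le_iInf₂ fun hl h => ?_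
  rw [ENNReal.div_le_iff h2N0 h2Nt, setLAverage_eq, ENNReal.div_le_iff hR hR']
  rw [setLAverage_eq, ENNReal.div_le_iff hR hR', one_mul] at h
  calc _ ≤ ∫⁻ x in R, l * N * (complementary Φ (v x * f x / N) +
        extend Φ ((v x : ℝ≥0∞)⁻¹ / l)) :=
        lintegral_mono fun x => coe_le_mul_complementary_add_extend Φ (v x) (f x) hN hl
    _ = l * N * ((∫⁻ x in R, complementary Φ (v x * f x / N)) +
        ∫⁻ x in R, extend Φ ((v x : ℝ≥0∞)⁻¹ / l)) := by
        rw [lintegral_const_mul' _ _ (ENNReal.mul_ne_top (by simp) (by simp)),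
          lintegral_add_left]
        exact (complementary_mono Φ).measurable.comp ((hv.mul hf).div_const N)
    _ ≤ l * N * (volume R + volume R) := by gcongr
    _ = _ := by ring

/-- The bump condition controls averages of `f` by Luxemburg norms of `v f` with respect to the
complementary function. -/
theorem BumpCondition.setLIntegral_mul_rpow_le {n : ℕ} {p : ℝ} (hp : 0 < p) {Φ : ℝ≥0 → ℝ≥0}
    {u v f : (Fin n → ℝ) → ℝ≥0} (hv : Measurable v) (hf : Measurable f)
    {K : ℝ≥0} {R : Set (Fin n → ℝ)}
    (hK : (⨍⁻ x in R, (u x : ℝ≥0∞) ^ p ∂volume) ^ (1 / p) *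
      luxemburgNorm Φ R (fun x => (v x : ℝ≥0∞)⁻¹) ≤ K) (hK0 : 0 < K)
    (hR : volume R ≠ 0) (hR' : volume R ≠ ⊤) :
    (⨍⁻ x in R, (f x : ℝ≥0∞) ∂volume) ^ p * ∫⁻ x in R, (u x : ℝ≥0∞) ^ p ≤
      (2 * K) ^ p * (⨅ (N : ℝ≥0) (_ : 0 < N)
        (_ : ∫⁻ x in R, complementary Φ (v x * f x / N) ≤ volume R), (N : ℝ≥0∞)) ^ p *
          volume R := by
  set A := ⨍⁻ x in R, (u x : ℝ≥0∞) ^ p ∂volume with hA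
  set a := ⨍⁻ x in R, (f x : ℝ≥0∞) ∂volume
  have h2K0 : (2 * K : ℝ≥0∞) ≠ 0 := mul_ne_zero two_ne_zero (by simpa using hK0.ne')
  have h2Kt : (2 * K : ℝ≥0∞) ≠ ⊤ := ENNReal.mul_ne_top (by simp) (by simp)
  have h1 : a * A ^ (1 / p) ≤ (2 * K) * ⨅ (N : ℝ≥0) (_ : 0 < N)
        (_ : ∫⁻ x in R, complementary Φ (v x * f x / N) ≤ volume R), (N : ℝ≥0∞) := by
    rw [mul_comm (2 * K : ℝ≥0∞), ← ENNReal.div_le_iff h2K0 h2Kt]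
    refine le_iInf fun N => le_iInf₂ fun hN h => ?_
    rw [ENNReal.div_le_iff h2K0 h2Kt]
    calc _ ≤ 2 * N * luxemburgNorm Φ R (fun x => (v x : ℝ≥0∞)⁻¹) * A ^ (1 / p) := by
          gcongr
          exact setLAverage_le_of_luxemburg Φ hv hf hR hR' hN h
      _ = 2 * N * (A ^ (1 / p) * luxemburgNorm Φ R (fun x => (v x : ℝ≥0∞)⁻¹)) := by ring
      _ ≤ 2 * N * K := by gcongr
      _ = _ := by ring
  have h2 := ENNReal.rpow_le_rpow h1 hp.le
  rw [ENNReal.mul_rpow_of_nonneg _ _ hp.le, ENNReal.mul_rpow_of_nonneg _ _ hp.le,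
    ← ENNReal.rpow_mul, one_div_mul_cancel hp.ne', ENNReal.rpow_one] at h2
  have h3 : ∫⁻ x in R, (u x : ℝ≥0∞) ^ p = A * volume R := by
    rw [hA, setLAverage_eq, ENNReal.div_mul_cancel hR hR']
  rw [h3, ← mul_assoc]
  gcongr

/-! ### Sufficiency of the condition -/

theorem measurable_finset_sup {α κ : Type*} [MeasurableSpace α] (J : Finset κ)
    {F : κ → α → ℝ≥0∞} (hF : ∀ i, Measurable (F i)) :
    Measurable fun x => J.sup fun i => F i x := by
  simp_rw [Finset.sup_eq_iSup]
  exact Measurable.biSup _ J.countable_toSet fun i _ => hF i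

theorem setOf_lt_finset_sup_indicator {α κ : Type*} (J : Finset κ) (R : κ → Set α)
    (a : κ → ℝ≥0∞) (c : ℝ≥0∞) :
    {x | c < J.sup fun i => (R i).indicator (fun _ => a i) x} ⊆
      ⋃ i ∈ {i | i ∈ J ∧ c < a i}, R i := by
  intro x hx
  obtain ⟨i, hi, hc⟩ := Finset.lt_sup_iff.1 (show c < _ from hx)
  have hxi : x ∈ R i := by
    by_contra h
    simp [h] at hc
  rw [Set.indicator_of_mem hxi] at hc
  exact Set.mem_biUnion (x := i) ⟨hi, hc⟩ hxi

/-- Condition (A) reduces a finite maximal operator to a scattered family. -/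
theorem ConditionA.exists_lintegral_rpow_le {n : ℕ} {p : ℝ} (hp : 0 < p)
    {w : (Fin n → ℝ) → ℝ≥0∞} (hA : ConditionA w) :
    ∃ C : ℝ≥0, ∀ {κ : Type} (R : κ → Set (Fin n → ℝ)), (∀ i, IsRectangle (R i)) →
      (∀ i, MeasurableSet (R i)) → (∀ i, volume (R i) ≠ 0) → (∀ i, volume (R i) ≠ ⊤) →
      ∀ (a : κ → ℝ≥0∞) (J : Finset κ), ∃ S ⊆ J, ∃ E : κ → Set (Fin n → ℝ),
        (∀ i ∈ S, MeasurableSet (E i) ∧ E i ⊆ R i ∧ volume (R i) ≤ C * volume (E i)) ∧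
        (S : Set κ).PairwiseDisjoint E ∧
        ∫⁻ x, (J.sup fun i => (R i).indicator (fun _ => a i) x) ^ p ∂(volume.withDensity w) ≤
          C * ∑ i ∈ S, a i ^ p * ∫⁻ x in R i, w x := by
  classical
  obtain ⟨l, hl0, hl1, c, hc, hA⟩ := hA
  have h1l : 0 < 1 - l := by linarith
  -- `c` is the constant of condition (A), and `1 / (1 - l)` compares `R i` with `E i`.
  refine ⟨max c (1 - l)⁻¹.toNNReal, fun {κ} R hRect hRm hR0 hRt a J => ?_⟩
  obtain ⟨S, hSJ, E, hE, hdisj, hcov⟩ :=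
    exists_scattered_subfamily volume R hRm hR0 hRt a hl0 hl1 J
  refine ⟨S, hSJ, E, fun i hi => ⟨(hE i hi).1, (hE i hi).2.1, ?_⟩, hdisj, ?_⟩
  · calc volume (R i) = ENNReal.ofReal (1 - l)⁻¹ * (ENNReal.ofReal (1 - l) * volume (R i)) := by
          rw [← mul_assoc, ← ENNReal.ofReal_mul (by positivity), inv_mul_cancel₀ h1l.ne']
          simp
      _ ≤ ENNReal.ofReal (1 - l)⁻¹ * volume (E i) := by gcongr; exact (hE i hi).2.2
      _ ≤ _ := by
          gcongr
          exact ENNReal.coe_le_coe.2 (le_max_right _ _)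
  have hM : Measurable fun x => J.sup fun i => (R i).indicator (fun _ => a i) x :=
    measurable_finset_sup J fun i => measurable_const.indicator (hRm i)
  have hlevel : ∀ t : ℝ, volume.withDensity w
      {x | ENNReal.ofReal t < J.sup fun i => (R i).indicator (fun _ => a i) x} ≤
      c * ∑ i ∈ S, if ENNReal.ofReal t < a i then ∫⁻ x in R i, w x else 0 := by
    intro t
    set U := ⋃ i ∈ {i | i ∈ S ∧ ENNReal.ofReal t < a i}, R i with hU
    have hcount : {i | i ∈ S ∧ ENNReal.ofReal t < a i}.Countable :=
      S.countable_toSet.mono fun i hi => hi.1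
    have hUm : MeasurableSet U := MeasurableSet.biUnion hcount fun i _ => hRm i
    -- A box with value above `t` is covered in proportion more than `l` by kept boxes with values
    -- at least as large, all of them part of `U`; so the maximal function of `χ_U` exceeds `l` on
    -- it.
    have hsub : {x | ENNReal.ofReal t < J.sup fun i => (R i).indicator (fun _ => a i) x} ⊆
        {x | ENNReal.ofReal l < strongMaximal (U.indicator fun _ => (1 : ℝ)) x} := by
      refine (setOf_lt_finset_sup_indicator J R a _).trans ?_
      refine Set.iUnion₂_subset fun j hj x hx => ?_
      refine lt_of_lt_of_le ?_ (le_iSup₂_of_le (f := fun (R : Set (Fin n → ℝ)) (_ : IsRectangle R) =>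
        ⨆ _ : x ∈ R, ⨍⁻ y in R, ‖U.indicator (fun _ => (1 : ℝ)) y‖ₑ ∂volume) (R j) (hRect j)
        (le_iSup_of_le hx le_rfl))
      have hint : ∫⁻ y in R j, ‖U.indicator (fun _ => (1 : ℝ)) y‖ₑ = volume (R j ∩ U) := by
        have : ∀ y, ‖U.indicator (fun _ => (1 : ℝ)) y‖ₑ = U.indicator 1 y := fun y => by
          by_cases hy : y ∈ U <;> simp [hy]
        simp_rw [this]
        rw [lintegral_indicator_one hUm, Measure.restrict_apply hUm, Set.inter_comm]
      rw [setLAverage_eq, hint, ENNReal.lt_div_iff_mul_lt (Or.inl (hR0 j)) (Or.inl (hRt j))]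
      refine (hcov j hj.1).trans_le (measure_mono (Set.inter_subset_inter_right _ ?_))
      exact Set.biUnion_subset_biUnion_left fun i hi => ⟨hi.1, hj.2.trans_le hi.2⟩
    calc _ ≤ volume.withDensity w
          {x | ENNReal.ofReal l < strongMaximal (U.indicator fun _ => (1 : ℝ)) x} :=
          measure_mono hsub
      _ ≤ c * volume.withDensity w U := by
          rw [withDensity_apply', withDensity_apply']
          exact hA U hUm
      _ ≤ c * ∑ i ∈ S.filter fun i => ENNReal.ofReal t < a i, volume.withDensity w (R i) := by
          gcongr
          refine le_trans (measure_mono ?_) (measure_biUnion_finset_le _ _)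
          rw [hU]
          exact Set.biUnion_subset_biUnion_left fun i hi => by
            simpa using hi
      _ = _ := by
          rw [Finset.sum_filter]
          simp_rw [withDensity_apply']
  rw [lintegral_rpow_eq_lintegral_meas_lt _ hp hM]
  calc _ ≤ ∫⁻ t in Set.Ioi (0 : ℝ), c * ∑ i ∈ S, (if ENNReal.ofReal t < a i then
        ENNReal.ofReal (p * t ^ (p - 1)) else 0) * ∫⁻ x in R i, w x := by
        refine lintegral_mono fun t => ?_
        refine (mul_le_mul_right (hlevel t) _).trans (le_of_eq ?_)
        rw [mul_left_comm, Finset.mul_sum]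
        congr 1
        refine Finset.sum_congr rfl fun i _ => ?_
        split_ifs <;> simp
    _ = c * ∑ i ∈ S, a i ^ p * ∫⁻ x in R i, w x := by
        have hm : ∀ i, Measurable fun t : ℝ => if ENNReal.ofReal t < a i then
            ENNReal.ofReal (p * t ^ (p - 1)) else 0 := fun i =>
          Measurable.ite (measurableSet_lt ENNReal.measurable_ofReal measurable_const)
            (by fun_prop) measurable_const
        rw [lintegral_const_mul' _ _ (by simp),
          lintegral_finsetSum _ (fun i _ => (hm i).mul_const _)]
        congr 1
        refine Finset.sum_congr rfl fun i _ => ?_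
        rw [lintegral_mul_const _ (hm i), rpow_eq_lintegral hp]
    _ ≤ _ := by
        gcongr
        exact le_max_left _ _

/-- Sums of powers of Luxemburg norms over a scattered family of rational rectangles. -/
theorem sum_iInf_rpow_mul_volume_le {n : ℕ} {p : ℝ} (hp : 0 < p) (ψ : ℝ≥0 → ℝ≥0)
    (g : (Fin n → ℝ) → ℝ≥0) {κ : Type*} (q : κ → (Fin n → ℚ) × (Fin n → ℚ))
    (S : Finset κ) (E : κ → Set (Fin n → ℝ))
    (hE : ∀ i ∈ S, MeasurableSet (E i) ∧ E i ⊆ ratBox (q i))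
    (hdisj : (S : Set κ).PairwiseDisjoint E) :
    ∑ i ∈ S, (⨅ (N : ℝ≥0) (_ : 0 < N) (_ : ∫⁻ x in ratBox (q i), (ψ (g x / N) : ℝ≥0∞) ≤
        volume (ratBox (q i))), (N : ℝ≥0∞)) ^ p * volume (E i) ≤
      ∫⁻ t in Set.Ioi (0 : ℝ), ENNReal.ofReal (p * t ^ (p - 1)) *
        volume (⋃ q ∈ {q : (Fin n → ℚ) × (Fin n → ℚ) |
          volume (ratBox q) < ∫⁻ x in ratBox q, (ψ (g x / t.toNNReal) : ℝ≥0∞)}, ratBox q) := by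
  classical
  set N : κ → ℝ≥0∞ := fun i => ⨅ (N : ℝ≥0) (_ : 0 < N)
    (_ : ∫⁻ x in ratBox (q i), (ψ (g x / N) : ℝ≥0∞) ≤ volume (ratBox (q i))), (N : ℝ≥0∞)
  have hm : ∀ i, Measurable fun t : ℝ => if ENNReal.ofReal t < N i then
      ENNReal.ofReal (p * t ^ (p - 1)) else 0 := fun i =>
    Measurable.ite (measurableSet_lt ENNReal.measurable_ofReal measurable_const)
      (by fun_prop) measurable_const
  calc _ = ∫⁻ t in Set.Ioi (0 : ℝ), ∑ i ∈ S, (if ENNReal.ofReal t < N i then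
        ENNReal.ofReal (p * t ^ (p - 1)) else 0) * volume (E i) := by
        rw [lintegral_finsetSum _ (fun i _ => (hm i).mul_const _)]
        refine Finset.sum_congr rfl fun i _ => ?_
        rw [lintegral_mul_const _ (hm i), ← rpow_eq_lintegral hp]
    _ = ∫⁻ t in Set.Ioi (0 : ℝ), ENNReal.ofReal (p * t ^ (p - 1)) *
        volume (⋃ i ∈ S.filter fun i => ENNReal.ofReal t < N i, E i) := by
        refine lintegral_congr fun t => ?_
        rw [measure_biUnion_finset, Finset.sum_filter, Finset.mul_sum]
        · refine Finset.sum_congr rfl fun i _ => ?_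
          split_ifs <;> simp
        · exact hdisj.subset fun i hi => (Finset.mem_filter.1 hi).1
        · exact fun i hi => (hE i (Finset.mem_filter.1 hi).1).1
    _ ≤ _ := by
        refine setLIntegral_mono' measurableSet_Ioi fun t ht => ?_
        have ht0 : 0 < t := ht
        gcongr
        refine Set.iUnion₂_subset fun i hi => ?_
        obtain ⟨hiS, hti⟩ := Finset.mem_filter.1 hi
        refine (hE i hiS).2.trans (Set.subset_biUnion_of_mem (u := ratBox) ?_)
        -- Otherwise `t` would be admissible in the infimum defining `N i`, against `t < N i`.
        by_contra h
        refine absurd hti (not_lt.2 ?_)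
        exact iInf_le_of_le t.toNNReal (iInf₂_le_of_le (Real.toNNReal_pos.2 ht0) (not_lt.1 h)
          le_rfl)

theorem strongMaximalBounded_of_strongBp {n : ℕ} (hn : 1 ≤ n) {p : ℝ} (hp : 0 < p)
    {Φ : ℝ≥0 → ℝ≥0} (h : StrongBp n p (complementary Φ)) {u v : (Fin n → ℝ) → ℝ≥0}
    (hu : Measurable u) (hv : Measurable v) (hA : ConditionA fun x => (u x : ℝ≥0∞) ^ p)
    (hbump : BumpCondition p Φ u v) : StrongMaximalBounded p u v := by
  set ψ : ℝ≥0 → ℝ≥0 := fun s => (complementary Φ s).toNNReal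
  have hfin := h.ne_top (complementary_mono Φ)
  have hcoe : ∀ s, (ψ s : ℝ≥0∞) = complementary Φ s := fun s => ENNReal.coe_toNNReal (hfin s)
  have hψ : Monotone ψ := fun s t hst =>
    ENNReal.toNNReal_mono (hfin t) (complementary_mono Φ hst)
  have hψ0 : ∀ ε : ℝ, 0 < ε → ∃ b : ℝ≥0, 0 < b ∧ ψ b ≤ ε := by
    intro ε hε
    -- For `θ ≤ 1` one has `ψ θ ≤ θ ψ 1`; the `+ 1` guards against `ψ 1 = 0`.
    refine ⟨min 1 (ε.toNNReal / (ψ 1 + 1)), lt_min one_pos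
      (div_pos (Real.toNNReal_pos.2 hε) (by positivity)), ?_⟩
    have h1 := complementary_mul_le Φ (min_le_left 1 (ε.toNNReal / (ψ 1 + 1))) 1
    rw [mul_one, ← hcoe, ← hcoe] at h1
    have h2 : ψ (min 1 (ε.toNNReal / (ψ 1 + 1))) ≤ min 1 (ε.toNNReal / (ψ 1 + 1)) * ψ 1 := by
      exact_mod_cast h1
    have h3 : min 1 (ε.toNNReal / (ψ 1 + 1)) * ψ 1 ≤ ε.toNNReal := by
      calc _ ≤ ε.toNNReal / (ψ 1 + 1) * (ψ 1 + 1) := by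
            gcongr
            · exact min_le_right _ _
            · exact le_self_add
        _ = _ := div_mul_cancel₀ _ (by positivity)
    have h4 := NNReal.coe_le_coe.2 (h2.trans h3)
    rwa [Real.coe_toNNReal _ hε.le] at h4
  have hB : StrongBp n p fun s => (ψ s : ℝ≥0∞) := by
    simp_rw [hcoe]
    exact h
  obtain ⟨C₁, hC₁⟩ := exists_lintegral_volume_iUnion_ratBox_le hn hp hψ hψ0 hB
  obtain ⟨C₂, hC₂⟩ := hA.exists_lintegral_rpow_le hp
  obtain ⟨K, hK0, hK⟩ := hbump
  refine ⟨C₂ * ((2 * K) ^ p * (C₂ * C₁)), fun f hf hf0 => ?_⟩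
  set g : (Fin n → ℝ) → ℝ≥0 := fun x => v x * (f x).toNNReal with hg
  have hgm : Measurable g := hv.mul hf.real_toNNReal
  let κ := {q : (Fin n → ℚ) × (Fin n → ℚ) // ∀ i, q.1 i < q.2 i}
  have hlt : ∀ q : κ, ∀ i, ((q.1.1 i : ℚ) : ℝ) < (q.1.2 i : ℝ) := fun q i =>
    Rat.cast_lt.2 (q.2 i)
  let a : κ → ℝ≥0∞ := fun q => ⨍⁻ y in ratBox q.1, ((f y).toNNReal : ℝ≥0∞) ∂volume
  let M : Finset κ → (Fin n → ℝ) → ℝ≥0∞ := fun J x =>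
    J.sup fun i => (ratBox i.1).indicator (fun _ => a i) x
  have hMm : ∀ J, Measurable (M J) := fun J => measurable_finset_sup J fun i =>
    measurable_const.indicator (measurableSet_box _ _)
  have hMmono : Monotone M := fun J J' hJ x => Finset.sup_mono hJ
  -- The bound does not depend on `J`, so monotone convergence extends it to all rational boxes.
  have hfinite : ∀ J : Finset κ, ∫⁻ x, ((u x : ℝ≥0∞) * M J x) ^ p ≤
      (C₂ * ((2 * K) ^ p * (C₂ * C₁)) : ℝ≥0) * ∫⁻ x, (g x : ℝ≥0∞) ^ p := by
    intro J
    obtain ⟨S, -, E, hE, hdisj, hle⟩ := hC₂ (fun q : κ => ratBox q.1)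
      (fun q => isRectangle_box (hlt q)) (fun q => measurableSet_box _ _)
      (fun q => volume_box_ne_zero (hlt q)) (fun q => volume_box_ne_top _ _) a J
    rw [lintegral_withDensity_eq_lintegral_mul _ (by fun_prop) ((hMm J).pow_const p)] at hle
    calc _ = ∫⁻ x, ((fun x => (u x : ℝ≥0∞) ^ p) * fun x => M J x ^ p) x := by
          refine lintegral_congr fun x => ?_
          rw [ENNReal.mul_rpow_of_nonneg _ _ hp.le, Pi.mul_apply]
      _ ≤ C₂ * ∑ i ∈ S, a i ^ p * ∫⁻ x in ratBox i.1, (u x : ℝ≥0∞) ^ p := hle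
      _ ≤ C₂ * ∑ i ∈ S, (2 * K) ^ p * (⨅ (N : ℝ≥0) (_ : 0 < N) (_ : ∫⁻ x in ratBox i.1,
            (ψ (g x / N) : ℝ≥0∞) ≤ volume (ratBox i.1)), (N : ℝ≥0∞)) ^ p *
              (C₂ * volume (E i)) := by
          refine mul_le_mul_right (Finset.sum_le_sum fun i hi => ?_) _
          refine (BumpCondition.setLIntegral_mul_rpow_le hp hv hf.real_toNNReal
            (hK _ (isRectangle_box (hlt i))) hK0 (volume_box_ne_zero (hlt i))
            (volume_box_ne_top _ _)).trans ?_
          simp_rw [hcoe]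
          exact mul_le_mul_right (hE i hi).2.2 _
      _ = C₂ * ((2 * K) ^ p * (C₂ * ∑ i ∈ S, (⨅ (N : ℝ≥0) (_ : 0 < N)
            (_ : ∫⁻ x in ratBox i.1, (ψ (g x / N) : ℝ≥0∞) ≤ volume (ratBox i.1)),
              (N : ℝ≥0∞)) ^ p * volume (E i))) := by
          congr 1
          rw [← mul_assoc, Finset.mul_sum]
          exact Finset.sum_congr rfl fun i _ => by ring
      _ ≤ C₂ * ((2 * K) ^ p * (C₂ * (C₁ * ∫⁻ x, (g x : ℝ≥0∞) ^ p))) := by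
          gcongr
          exact (sum_iInf_rpow_mul_volume_le hp ψ g (fun q : κ => q.1) S E
            (fun i hi => ⟨(hE i hi).1, (hE i hi).2.1⟩) hdisj).trans (hC₁ g hgm)
      _ = _ := by
          push_cast
          rw [ENNReal.coe_rpow_of_nonneg _ hp.le]
          push_cast
          ring
  have hsup : ∀ x, ((u x : ℝ≥0∞) * strongMaximal f x) ^ p ≤
      ⨆ J : Finset κ, ((u x : ℝ≥0∞) * M J x) ^ p := by
    intro x
    have h1 : strongMaximal f x ≤ ⨆ J : Finset κ, M J x := by
      refine (strongMaximal_le_iSup_ratBox f x).trans (iSup_le fun q => ?_)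
      have e : ∀ y, ‖f y‖ₑ = ((f y).toNNReal : ℝ≥0∞) := fun y => by
        rw [Real.enorm_of_nonneg (hf0 y)]; rfl
      simp_rw [e]
      refine le_iSup_of_le {q} ?_
      simp [M, a]
    calc _ ≤ ((u x : ℝ≥0∞) * ⨆ J : Finset κ, M J x) ^ p := by gcongr
      _ = _ := by
        rw [ENNReal.mul_iSup]
        exact (ENNReal.orderIsoRpow p hp).map_iSup _
  calc _ ≤ ∫⁻ x, ⨆ J : Finset κ, ((u x : ℝ≥0∞) * M J x) ^ p := lintegral_mono hsup
    _ = ⨆ J : Finset κ, ∫⁻ x, ((u x : ℝ≥0∞) * M J x) ^ p := by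
        refine lintegral_iSup_directed_of_measurable
          (fun J => (hu.coe_nnreal_ennreal.mul (hMm J)).pow_const p) ?_
        refine Monotone.directed_le fun J J' hJ x => ?_
        have := hMmono hJ x
        simp only
        gcongr
    _ ≤ _ := by
        refine iSup_le fun J => (hfinite J).trans (le_of_eq ?_)
        congr 1

/-! ### Integrals of products and the measure of hyperbolic regions -/

theorem lintegral_pi_prod_eq_prod {ι : Type*} [Fintype ι] [DecidableEq ι] (μ : ι → Measure ℝ)
    [∀ i, SigmaFinite (μ i)] {f : ι → ℝ → ℝ≥0∞} (hf : ∀ i, Measurable (f i)) :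
    ∫⁻ x, ∏ i, f i (x i) ∂(Measure.pi μ) = ∏ i, ∫⁻ t, f i t ∂(μ i) := by
  have hmeas : ∀ s : Finset ι, Measurable fun x : ι → ℝ => ∏ i ∈ s, f i (x i) := fun s =>
    Finset.measurable_fun_prod s fun i _ => (hf i).comp (measurable_pi_apply i)
  have key : ∀ (s : Finset ι) (x : ι → ℝ),
      (∫⋯∫⁻_s, (fun x => ∏ i ∈ s, f i (x i)) ∂μ) x = ∏ i ∈ s, ∫⁻ t, f i t ∂(μ i) := by
    intro s
    induction s using Finset.induction_on with
    | empty => simp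
    | insert i s hi ih =>
      intro x
      have hm : Measurable fun y : s → ℝ => ∏ j ∈ s, f j (Function.updateFinset x s y j) :=
        (hmeas s).comp measurable_updateFinset
      rw [lmarginal_insert' _ (hmeas _) hi, Finset.prod_insert hi, ← ih x, lmarginal, lmarginal,
        ← lintegral_const_mul _ hm]
      refine lintegral_congr fun y => ?_
      rw [← lintegral_mul_const _ (hf i)]
      refine lintegral_congr fun t => ?_
      rw [Finset.prod_insert hi, Function.update_self]
      congr 1
      refine Finset.prod_congr rfl fun j hj => ?_
      rw [Function.update_of_ne (by rintro rfl; exact hi hj)]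
  have := key Finset.univ 0
  rwa [lmarginal_univ] at this

theorem setLIntegral_box_prod {n : ℕ} (a b : Fin n → ℝ) {f : ℝ → ℝ≥0∞} (hf : Measurable f) :
    ∫⁻ x in box a b, ∏ i, f (x i) = ∏ i, ∫⁻ t in Set.Ioo (a i) (b i), f t := by
  rw [box, volume_pi, Measure.restrict_pi_pi]
  exact lintegral_pi_prod_eq_prod _ fun _ => hf

/-- The hyperbolic product `∏ (1 + |x i|)`. -/
def hypProd {n : ℕ} (x : Fin n → ℝ) : ℝ≥0 := ∏ i, (1 + ‖x i‖₊)

theorem continuous_hypProd {n : ℕ} : Continuous (hypProd (n := n)) := by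
  unfold hypProd; fun_prop

theorem one_le_hypProd {n : ℕ} (x : Fin n → ℝ) : 1 ≤ hypProd x :=
  Finset.one_le_prod' fun _ _ => le_self_add

theorem coe_hypProd {n : ℕ} (x : Fin n → ℝ) : (hypProd x : ℝ) = ∏ i, (1 + |x i|) := by
  simp [hypProd]

theorem setLIntegral_inv_one_add {T : ℝ} (hT : 0 ≤ T) :
    ∫⁻ t in Set.Ioo 0 T, ENNReal.ofReal (1 + t)⁻¹ = ENNReal.ofReal (Real.log (1 + T)) := by
  have hII : IntervalIntegrable (fun t : ℝ => (1 + t)⁻¹) volume 0 T := by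
    refine intervalIntegral.intervalIntegrable_inv (fun t ht => ?_) (by fun_prop)
    rw [Set.uIcc_of_le hT] at ht
    linarith [ht.1]
  rw [restrict_Ioo_eq_restrict_Ioc, ← ofReal_integral_eq_lintegral_ofReal
    ((intervalIntegrable_iff_integrableOn_Ioc_of_le hT).1 hII)
    ((ae_restrict_iff' measurableSet_Ioc).2 (Filter.Eventually.of_forall fun t ht => by
      have : 0 < t := ht.1
      simp only [Pi.zero_apply]
      positivity)), ← intervalIntegral.integral_of_le hT,
    intervalIntegral.integral_comp_add_left (fun t => t⁻¹), integral_inv_of_pos (by norm_num)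
      (by linarith)]
  simp

/-- Fix all coordinates but the first in `(0, T)` and let `P` be the product of their factors. Since
`P ≤ y / 2`, the first coordinate ranges over an interval of length `y / P - 1 ≥ y / (2 P)`, and
integrating `1 / P` gives the power of the logarithm. -/
theorem ofReal_mul_log_pow_le_volume_hypProd_lt (m : ℕ) {y T : ℝ} (hT : 0 ≤ T)
    (hy : (1 + T) ^ m ≤ y / 2) :
    ENNReal.ofReal (y / 2 * Real.log (1 + T) ^ m) ≤
      volume {x : Fin (m + 1) → ℝ | (hypProd x : ℝ) < y} := by
  have hy0 : 0 < y := by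
    have : 0 < (1 + T) ^ m := by positivity
    linarith
  set B : Set (ℝ × (Fin m → ℝ)) := {z | (∀ i, z.2 i ∈ Set.Ioo 0 T) ∧ 0 < z.1 ∧
    (1 + z.1) * ∏ i, (1 + z.2 i) < y} with hB
  have hBm : MeasurableSet B := by
    have h1 : MeasurableSet {z : ℝ × (Fin m → ℝ) | ∀ i, z.2 i ∈ Set.Ioo 0 T} := by
      rw [Set.ofPred_forall]
      exact MeasurableSet.iInter fun i => measurableSet_Ioo.preimage (by fun_prop)
    have h2 : MeasurableSet {z : ℝ × (Fin m → ℝ) | 0 < z.1} :=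
      measurableSet_lt measurable_const measurable_fst
    have h3 : MeasurableSet {z : ℝ × (Fin m → ℝ) | (1 + z.1) * ∏ i, (1 + z.2 i) < y} :=
      (isOpen_lt (by fun_prop) continuous_const).measurableSet
    exact h1.inter (h2.inter h3)
  have hmp := volume_preserving_piFinSuccAbove (fun _ : Fin (m + 1) => ℝ) 0
  have hsub : (MeasurableEquiv.piFinSuccAbove (fun _ : Fin (m + 1) => ℝ) 0) ⁻¹' B ⊆
      {x : Fin (m + 1) → ℝ | (hypProd x : ℝ) < y} := by
    intro x hx
    obtain ⟨h1, h2, h3⟩ := hx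
    change ∀ i : Fin m, x i.succ ∈ Set.Ioo 0 T at h1
    change 0 < x 0 at h2
    change (1 + x 0) * ∏ i : Fin m, (1 + x i.succ) < y at h3
    change (hypProd x : ℝ) < y
    rw [coe_hypProd, Fin.prod_univ_succ, abs_of_pos h2]
    simp_rw [fun i : Fin m => abs_of_pos (h1 i).1]
    exact h3
  refine le_trans ?_ (measure_mono hsub)
  rw [hmp.measure_preimage hBm.nullMeasurableSet, Measure.volume_eq_prod,
    Measure.prod_apply_symm hBm]
  have hslice : ∀ x' ∈ box (fun _ : Fin m => (0 : ℝ)) (fun _ => T),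
      ENNReal.ofReal (y / 2) * ∏ i, ENNReal.ofReal (1 + x' i)⁻¹ ≤
        volume ((fun x => (x, x')) ⁻¹' B) := by
    intro x' hx'
    have hpos : ∀ i, 0 < 1 + x' i := fun i => by linarith [(hx' i trivial).1]
    set P := ∏ i, (1 + x' i) with hP
    have hP0 : 0 < P := Finset.prod_pos fun i _ => hpos i
    have hPle : P ≤ y / 2 := by
      refine le_trans ?_ hy
      calc P ≤ ∏ _i : Fin m, (1 + T) := Finset.prod_le_prod (fun i _ => (hpos i).le)
            fun i _ => by linarith [(hx' i trivial).2]
        _ = _ := by simp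
    have hIoo : Set.Ioo 0 (y / P - 1) ⊆ (fun x => (x, x')) ⁻¹' B := by
      intro t ht
      refine ⟨fun i => hx' i trivial, ht.1, ?_⟩
      have := ht.2
      rw [lt_sub_iff_add_lt', lt_div_iff₀ hP0] at this
      exact this
    refine le_trans ?_ (measure_mono hIoo)
    rw [Real.volume_Ioo, ← ENNReal.ofReal_prod_of_nonneg (fun i _ => (inv_pos.2 (hpos i)).le),
      ← ENNReal.ofReal_mul (by positivity), Finset.prod_inv_distrib, ← hP]
    refine ENNReal.ofReal_le_ofReal ?_
    have : 1 ≤ y / 2 * P⁻¹ := by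
      rw [← div_eq_mul_inv, one_le_div hP0]; exact hPle
    have e : y / P = 2 * (y / 2 * P⁻¹) := by field_simp
    linarith
  calc _ = ∫⁻ x' in box (fun _ : Fin m => (0 : ℝ)) (fun _ => T),
        ENNReal.ofReal (y / 2) * ∏ i, ENNReal.ofReal (1 + x' i)⁻¹ := by
        rw [lintegral_const_mul' _ _ (by simp), setLIntegral_box_prod _ _
          (f := fun t => ENNReal.ofReal (1 + t)⁻¹) (by fun_prop)]
        simp only [setLIntegral_inv_one_add hT, Finset.prod_const, Finset.card_univ,
          Fintype.card_fin]
        rw [ENNReal.ofReal_mul (by positivity),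
          ENNReal.ofReal_pow (Real.log_nonneg (by linarith))]
    _ ≤ ∫⁻ x' in box (fun _ : Fin m => (0 : ℝ)) (fun _ => T),
          volume ((fun x => (x, x')) ⁻¹' B) := setLIntegral_mono' (measurableSet_box _ _) hslice
    _ ≤ _ := setLIntegral_le_lintegral _ _

theorem exists_logBump_le_volume_hypProd_lt {n : ℕ} (hn : 1 ≤ n) :
    ∃ C : ℝ≥0, ∀ y : ℝ≥0∞, 4 ≤ y →
      logBump n y ≤ C * volume {x : Fin n → ℝ | (hypProd x : ℝ≥0∞) < y} := by
  obtain ⟨m, rfl⟩ : ∃ m, n = m + 1 := ⟨n - 1, by omega⟩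
  refine ⟨(2 * (4 * (m + 1)) ^ m : ℝ≥0), fun y hy => ?_⟩
  induction y with
  | top =>
    have : {x : Fin (m + 1) → ℝ | (hypProd x : ℝ≥0∞) < ⊤} = Set.univ := by
      ext x; simp
    rw [this, volume_pi, Measure.pi_univ]
    simp only [Real.volume_univ, Finset.prod_const, Finset.card_univ, Fintype.card_fin]
    rw [ENNReal.top_pow (by omega), ENNReal.mul_top]
    · exact le_top
    · positivity
  | coe y =>
    have hy4 : (4 : ℝ) ≤ y := by exact_mod_cast hy
    have hset : {x : Fin (m + 1) → ℝ | (hypProd x : ℝ≥0∞) < y} =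
        {x : Fin (m + 1) → ℝ | (hypProd x : ℝ) < y} := by
      ext x; simp
    set Q : ℝ := (y : ℝ) / 2
    have hQ : 1 ≤ Q := by simp only [Q]; linarith
    have hTpos : (1 : ℝ) ≤ Q ^ (1 / (m + 1) : ℝ) := Real.one_le_rpow hQ (by positivity)
    -- Here `1 + T = (y / 2)^(1 / (m + 1))`, so `log (1 + T)` is comparable to `log y`; the exponent
    -- `1 / (m + 1)` also makes sense for `m = 0`.
    have h1 := ofReal_mul_log_pow_le_volume_hypProd_lt m (y := y) (T := Q ^ (1 / (m + 1) : ℝ) - 1)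
      (by linarith) (by
        rw [add_sub_cancel, ← Real.rpow_natCast, ← Real.rpow_mul (by linarith)]
        calc _ ≤ Q ^ (1 : ℝ) := by
              refine Real.rpow_le_rpow_of_exponent_le hQ ?_
              rw [one_div_mul_eq_div, div_le_one (by positivity)]
              linarith
          _ = _ := Real.rpow_one _)
    rw [add_sub_cancel, Real.log_rpow (by linarith)] at h1
    have hexp : Real.exp 1 < 3 := Real.exp_one_lt_three
    have hlog : Real.log (Real.exp 1 + y) ≤ 4 * Real.log Q := by
      have : Real.exp 1 + y ≤ Q ^ 4 := by
        have : (y : ℝ) = 2 * Q := by simp only [Q]; ring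
        rw [this]
        have hQ2 : 2 ≤ Q := by linarith
        have h2 : 4 ≤ Q ^ 2 := by nlinarith
        have h3 : 4 * Q ^ 2 ≤ Q ^ 4 := by nlinarith
        nlinarith
      calc _ ≤ Real.log (Q ^ 4) := Real.log_le_log (by positivity) this
        _ = _ := by rw [Real.log_pow]; norm_num
    rw [hset, logBump_coe, logKernel, Nat.add_sub_cancel]
    refine le_trans ?_ (mul_le_mul_right h1 _)
    rw [← ENNReal.ofReal_coe_nnreal (p := (2 * (4 * (m + 1)) ^ m : ℝ≥0)),
      ← ENNReal.ofReal_mul (NNReal.coe_nonneg _)]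
    refine ENNReal.ofReal_le_ofReal ?_
    push_cast
    have hl0 := one_le_log_exp_one_add (y := y) (by linarith)
    calc (y : ℝ) * Real.log (Real.exp 1 + y) ^ m ≤ y * (4 * Real.log Q) ^ m := by gcongr
      _ = 2 * (4 * (m + 1)) ^ m * (y / 2 * (1 / (m + 1) * Real.log Q) ^ m) := by
          rw [show (4 : ℝ) * Real.log Q = (4 * (m + 1)) * (1 / (m + 1) * Real.log Q) by
            field_simp, mul_pow (4 * (m + 1) : ℝ)]
          ring

/-! ### Young functions -/

theorem IsYoung.map_mul_le {Φ : ℝ≥0 → ℝ≥0} (hΦ : IsYoung Φ) {θ : ℝ≥0} (hθ : θ ≤ 1) (t : ℝ≥0) :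
    Φ (θ * t) ≤ θ * Φ t := by
  have := hΦ.convex.2 (Set.mem_univ t) (Set.mem_univ 0) zero_le zero_le
    (add_tsub_cancel_of_le hθ)
  simpa [hΦ.map_zero] using this

theorem IsYoung.surjective {Φ : ℝ≥0 → ℝ≥0} (hΦ : IsYoung Φ) : Function.Surjective Φ := by
  intro y
  obtain ⟨b, hb⟩ := (hΦ.tendsto.eventually_ge_atTop y).exists
  obtain ⟨x, -, hx⟩ := intermediate_value_Icc (zero_le (a := b)) hΦ.continuous.continuousOn
    (show y ∈ Set.Icc (Φ 0) (Φ b) from ⟨by simp [hΦ.map_zero], hb⟩)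
  exact ⟨x, hx⟩

/-- A Young function as an order isomorphism. -/
def IsYoung.orderIso {Φ : ℝ≥0 → ℝ≥0} (hΦ : IsYoung Φ) : ℝ≥0 ≃o ℝ≥0 :=
  hΦ.strictMono.orderIsoOfSurjective Φ hΦ.surjective

theorem IsYoung.map_orderIso_symm {Φ : ℝ≥0 → ℝ≥0} (hΦ : IsYoung Φ) (y : ℝ≥0) :
    Φ (hΦ.orderIso.symm y) = y :=
  hΦ.orderIso.apply_symm_apply y

theorem IsYoung.orderIso_symm_pos {Φ : ℝ≥0 → ℝ≥0} (hΦ : IsYoung Φ) {y : ℝ≥0} (hy : 0 < y) :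
    0 < hΦ.orderIso.symm y := by
  refine pos_iff_ne_zero.2 fun h => hy.ne' ?_
  rw [← hΦ.map_orderIso_symm y, h, hΦ.map_zero]

/-- By convexity `Φ(t) / t` is nondecreasing, so `r t ≤ Φ(t)` for all `t ≥ a`. Only `t ≤ a` can
contribute, and there `r t ≤ r a ≤ Φ(a)`. -/
theorem IsYoung.complementary_le {Φ : ℝ≥0 → ℝ≥0} (hΦ : IsYoung Φ) {a r : ℝ≥0}
    (ha : 0 < a) (hr : r * a ≤ Φ a) : complementary Φ r ≤ Φ a := by
  refine iSup₂_le fun t ht => ?_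
  rcases le_total t a with h | h
  · refine tsub_le_self.trans ?_
    have : r * t ≤ Φ a := (mul_le_mul_right h r).trans hr
    exact_mod_cast this
  · have h1 := hΦ.map_mul_le (div_le_one_of_le₀ h zero_le) t
    rw [div_mul_cancel₀ _ ht.ne'] at h1
    have h2 : r * t ≤ Φ t := by
      have h3 : r * a ≤ a * (Φ t / t) := hr.trans (h1.trans (le_of_eq (by ring)))
      rw [mul_comm r] at h3
      have h4 := le_of_mul_le_mul_left h3 ha
      rwa [le_div_iff₀ ht] at h4
    rw [tsub_eq_zero_of_le (by exact_mod_cast h2)]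
    exact zero_le

theorem exists_complementary_ge (Φ : ℝ≥0 → ℝ≥0) (y : ℝ≥0) :
    ∃ b : ℝ≥0, 0 < b ∧ ∀ r, b ≤ r → (y : ℝ≥0∞) ≤ complementary Φ r := by
  refine ⟨y + Φ 1 + 1, by positivity, fun r hr => ?_⟩
  refine le_iSup₂_of_le (f := fun (t : ℝ≥0) (_ : 0 < t) => ((r : ℝ≥0∞) * t - Φ t)) 1 one_pos ?_
  rw [ENNReal.coe_one, mul_one]
  refine ENNReal.le_sub_of_add_le_right (by simp) ?_
  have : y + Φ 1 ≤ r := le_self_add.trans hr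
  exact_mod_cast this

/-! ### Necessity of the condition -/

/-- If `b - a ≥ (1 + |x|) / 2`, the integral over the whole line, `π ≤ 4`, suffices. On a shorter
interval `1 + |x| ≤ 2 (1 + |y|) ≤ 3 (1 + y²)` for every `y` in it. -/
theorem ofReal_mul_setLIntegral_inv_le {a b x : ℝ} (hx : x ∈ Set.Ioo a b) :
    ENNReal.ofReal (1 + |x|) * ∫⁻ y in Set.Ioo a b, ENNReal.ofReal (1 + y ^ 2)⁻¹ ≤
      8 * ENNReal.ofReal (b - a) := by
  have hab : a < b := hx.1.trans hx.2
  have h8 : (8 : ℝ≥0∞) * ENNReal.ofReal (b - a) = ENNReal.ofReal (8 * (b - a)) := by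
    rw [ENNReal.ofReal_mul (by norm_num), ENNReal.ofReal_ofNat]
  rw [h8]
  rcases le_total ((1 + |x|) / 2) (b - a) with h | h
  · have h1 : ∫⁻ y in Set.Ioo a b, ENNReal.ofReal (1 + y ^ 2)⁻¹ ≤ ENNReal.ofReal 4 := by
      calc _ ≤ ∫⁻ y, ENNReal.ofReal (1 + y ^ 2)⁻¹ := setLIntegral_le_lintegral _ _
        _ = ENNReal.ofReal Real.pi := by
            rw [← ofReal_integral_eq_lintegral_ofReal integrable_inv_one_add_sq
              (Filter.Eventually.of_forall fun y => by positivity), integral_univ_inv_one_add_sq]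
        _ ≤ _ := ENNReal.ofReal_le_ofReal Real.pi_le_four
    calc _ ≤ ENNReal.ofReal (1 + |x|) * ENNReal.ofReal 4 := by gcongr
      _ = ENNReal.ofReal ((1 + |x|) * 4) := (ENNReal.ofReal_mul (by positivity)).symm
      _ ≤ _ := ENNReal.ofReal_le_ofReal (by linarith)
  · rw [← lintegral_const_mul' _ _ (by simp)]
    calc _ ≤ ∫⁻ _y in Set.Ioo a b, ENNReal.ofReal 3 := by
          refine setLIntegral_mono' measurableSet_Ioo fun y hy => ?_
          rw [← ENNReal.ofReal_mul (by positivity)]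
          refine ENNReal.ofReal_le_ofReal ?_
          rw [← div_eq_mul_inv, div_le_iff₀ (by positivity)]
          have h1 : |x| ≤ |y| + (b - a) := by
            have h2 : |x - y| ≤ b - a := by
              rw [abs_le]; constructor <;> linarith [hx.1, hx.2, hy.1, hy.2]
            have h3 := abs_add_le (x - y) y
            rw [sub_add_cancel] at h3
            linarith
          nlinarith [sq_nonneg (|y| - 1), sq_abs y]
      _ = ENNReal.ofReal (3 * (b - a)) := by
          rw [setLIntegral_const, Real.volume_Ioo, ← ENNReal.ofReal_mul (by norm_num)]
      _ ≤ _ := ENNReal.ofReal_le_ofReal (by linarith)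

/-- The weight `∏ (1 + (y i)²)`. -/
def sqProd {n : ℕ} (y : Fin n → ℝ) : ℝ≥0 := ∏ i, (1 + ‖y i‖₊ ^ 2)

theorem continuous_sqProd {n : ℕ} : Continuous (sqProd (n := n)) := by
  unfold sqProd; fun_prop

theorem one_le_sqProd {n : ℕ} (x : Fin n → ℝ) : 1 ≤ sqProd x :=
  Finset.one_le_prod' fun _ _ => le_self_add

theorem coe_inv_sqProd {n : ℕ} (y : Fin n → ℝ) :
    (((sqProd y)⁻¹ : ℝ≥0) : ℝ≥0∞) = ∏ i, ENNReal.ofReal (1 + y i ^ 2)⁻¹ := by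
  rw [← ENNReal.ofReal_prod_of_nonneg (fun i _ => by positivity), ← ENNReal.ofReal_coe_nnreal]
  congr 1
  simp [sqProd]

theorem hypProd_mul_setLIntegral_le {n : ℕ} {a b x : Fin n → ℝ} (hx : x ∈ box a b) :
    (hypProd x : ℝ≥0∞) * ∫⁻ y in box a b, (((sqProd y)⁻¹ : ℝ≥0) : ℝ≥0∞) ≤
      8 ^ n * volume (box a b) := by
  simp_rw [coe_inv_sqProd]
  rw [setLIntegral_box_prod a b (f := fun t => ENNReal.ofReal (1 + t ^ 2)⁻¹) (by fun_prop),
    volume_box, ← ENNReal.ofReal_coe_nnreal, coe_hypProd,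
    ENNReal.ofReal_prod_of_nonneg (fun i _ => by positivity), ← Finset.prod_mul_distrib]
  calc _ ≤ ∏ i, 8 * ENNReal.ofReal (b i - a i) :=
        Finset.prod_le_prod' fun i _ => ofReal_mul_setLIntegral_inv_le (hx i trivial)
    _ = _ := by rw [Finset.prod_mul_distrib]; simp

theorem isWeight_of_continuous {n : ℕ} {w : (Fin n → ℝ) → ℝ≥0} (hw : Continuous w) :
    IsWeight w := by
  refine ⟨hw.measurable, ?_⟩
  rintro R ⟨a, b, -, rfl⟩
  have hc : IsCompact (Set.univ.pi fun i => Set.Icc (a i) (b i)) :=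
    isCompact_univ_pi fun i => isCompact_Icc
  obtain ⟨M, hM⟩ := (hc.image hw).bddAbove
  have hsub : (Set.univ.pi fun i => Set.Ioo (a i) (b i)) ⊆
      Set.univ.pi fun i => Set.Icc (a i) (b i) := Set.pi_mono fun i _ => Set.Ioo_subset_Icc_self
  calc _ ≤ ∫⁻ _x in Set.univ.pi fun i => Set.Ioo (a i) (b i), (M : ℝ≥0∞) :=
        setLIntegral_mono' (measurableSet_box a b) fun x hx =>
          ENNReal.coe_le_coe.2 (hM ⟨x, hsub hx, rfl⟩)
    _ < ⊤ := by
        rw [setLIntegral_const]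
        exact ENNReal.mul_lt_top (by simp) (volume_box_ne_top a b).lt_top

theorem IsYoung.mul_luxemburgNorm_le {Φ : ℝ≥0 → ℝ≥0} (hΦ : IsYoung Φ) {n : ℕ}
    {a b x : Fin n → ℝ} (hx : x ∈ box a b) :
    (hΦ.orderIso.symm (hypProd x) : ℝ≥0∞) *
      luxemburgNorm Φ (box a b) (fun y => (sqProd y : ℝ≥0∞)⁻¹) ≤ (8 ^ n : ℝ≥0) := by
  have hs0 : 0 < hypProd x := one_pos.trans_le (one_le_hypProd x)
  set c := hΦ.orderIso.symm (hypProd x) with hc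
  have hc0 : 0 < c := hΦ.orderIso_symm_pos hs0
  have hab : ∀ i, a i < b i := fun i => (hx i trivial).1.trans (hx i trivial).2
  set K : ℝ≥0 := 8 ^ n with hK
  have hK1 : 1 ≤ K := one_le_pow₀ (by norm_num)
  have hK0 : 0 < K := one_pos.trans_le hK1
  suffices h : luxemburgNorm Φ (box a b) (fun y => (sqProd y : ℝ≥0∞)⁻¹) ≤ (K / c : ℝ≥0) by
    calc _ ≤ (c : ℝ≥0∞) * (K / c : ℝ≥0) := by gcongr
      _ = _ := by norm_cast; field_simp
  -- `K / c` is admissible: convexity gives `Φ(v⁻¹ c / K) ≤ v⁻¹ Φ(c) / K`, and `Φ(c) = hypProd x` is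
  -- balanced by the average of `v⁻¹`.
  refine iInf_le_of_le (K / c) (iInf₂_le_of_le (div_pos hK0 hc0) ?_ le_rfl)
  rw [setLAverage_eq, ENNReal.div_le_iff (volume_box_ne_zero hab) (volume_box_ne_top a b), one_mul]
  have hpt : ∀ y : Fin n → ℝ, extend Φ ((sqProd y : ℝ≥0∞)⁻¹ / (K / c : ℝ≥0)) ≤
      (K⁻¹ : ℝ≥0) * (hypProd x * ((sqProd y)⁻¹ : ℝ≥0)) := by
    intro y
    have hv0 : 0 < sqProd y := one_pos.trans_le (one_le_sqProd y)
    have h1 : (sqProd y : ℝ≥0∞)⁻¹ / (K / c : ℝ≥0) =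
        (((sqProd y)⁻¹ * K⁻¹ * c : ℝ≥0) : ℝ≥0∞) := by
      rw [← ENNReal.coe_inv hv0.ne', ← ENNReal.coe_div (div_pos hK0 hc0).ne']
      congr 1
      field_simp
    have h2 := hΦ.map_mul_le (θ := (sqProd y)⁻¹ * K⁻¹)
      (mul_le_one' (inv_le_one_of_one_le₀ (one_le_sqProd y)) (inv_le_one_of_one_le₀ hK1)) c
    rw [hc, hΦ.map_orderIso_symm, ← hc] at h2
    rw [h1]
    simp only [extend, ENNReal.coe_ne_top, if_false, ENNReal.toNNReal_coe]
    calc _ ≤ (((sqProd y)⁻¹ * K⁻¹ * hypProd x : ℝ≥0) : ℝ≥0∞) := ENNReal.coe_le_coe.2 h2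
      _ = _ := by push_cast; ring
  calc _ ≤ ∫⁻ y in box a b, (K⁻¹ : ℝ≥0) * (hypProd x * ((sqProd y)⁻¹ : ℝ≥0) : ℝ≥0∞) :=
        lintegral_mono hpt
    _ = (K⁻¹ : ℝ≥0) * (hypProd x * ∫⁻ y in box a b, (((sqProd y)⁻¹ : ℝ≥0) : ℝ≥0∞)) := by
        rw [lintegral_const_mul' _ _ (by simp), lintegral_const_mul' _ _ (by simp)]
    _ ≤ (K⁻¹ : ℝ≥0) * (8 ^ n * volume (box a b)) := by
        exact mul_le_mul_right (hypProd_mul_setLIntegral_le hx) _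
    _ = volume (box a b) := by
        have : ((K⁻¹ : ℝ≥0) : ℝ≥0∞) * 8 ^ n = 1 := by
          have : ((K⁻¹ * K : ℝ≥0) : ℝ≥0∞) = 1 := by rw [inv_mul_cancel₀ hK0.ne']; rfl
          rw [ENNReal.coe_mul] at this
          simpa [hK] using this
        rw [← mul_assoc, this, one_mul]

/-- The bound `u(x) ‖v⁻¹‖ ≤ 8 ^ n` holds at every point of the rectangle, so it survives taking the
p-th power mean of `u`. -/
theorem IsYoung.bumpCondition {Φ : ℝ≥0 → ℝ≥0} (hΦ : IsYoung Φ) {n : ℕ} {p : ℝ} (hp : 0 < p) :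
    BumpCondition p Φ (fun x : Fin n → ℝ => hΦ.orderIso.symm (hypProd x)) sqProd := by
  refine ⟨8 ^ n, by positivity, ?_⟩
  rintro R ⟨a, b, hab, rfl⟩
  change (⨍⁻ x in box a b, _ ∂volume) ^ (1 / p) * luxemburgNorm Φ (box a b) _ ≤ _
  set N := luxemburgNorm Φ (box a b) (fun y => (sqProd y : ℝ≥0∞)⁻¹) with hN
  set K : ℝ≥0 := 8 ^ n
  set u : (Fin n → ℝ) → ℝ≥0 := fun x => hΦ.orderIso.symm (hypProd x)
  have hmul : ∀ x ∈ box a b, (u x : ℝ≥0∞) * N ≤ K := fun x hx => hΦ.mul_luxemburgNorm_le hx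
  have hV0 := volume_box_ne_zero hab
  have hVt := volume_box_ne_top a b
  have hu : Measurable fun x => (u x : ℝ≥0∞) ^ p := by
    have : Measurable u := (hΦ.orderIso.symm.continuous.comp continuous_hypProd).measurable
    fun_prop
  have h1 : (⨍⁻ x in box a b, (u x : ℝ≥0∞) ^ p ∂volume) * N ^ p ≤ (K : ℝ≥0∞) ^ p := by
    rw [setLAverage_eq, ← ENNReal.mul_div_right_comm, ENNReal.div_le_iff hV0 hVt,
      ← lintegral_mul_const _ hu, ← setLIntegral_const]
    refine setLIntegral_mono' (measurableSet_box a b) fun x hx => ?_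
    rw [← ENNReal.mul_rpow_of_nonneg _ _ hp.le]
    exact ENNReal.rpow_le_rpow (hmul x hx) hp.le
  have h2 := ENNReal.rpow_le_rpow h1 (one_div_nonneg.2 hp.le)
  rwa [ENNReal.mul_rpow_of_nonneg _ _ (one_div_nonneg.2 hp.le), ← ENNReal.rpow_mul,
    ← ENNReal.rpow_mul, mul_one_div_cancel hp.ne', ENNReal.rpow_one, ENNReal.rpow_one] at h2

theorem inv_hypProd_le_strongMaximal {n : ℕ} (x : Fin n → ℝ) :
    (hypProd x : ℝ≥0∞)⁻¹ ≤
      strongMaximal ((box (fun _ => -1) fun _ => 1).indicator fun _ => (1 : ℝ)) x := by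
  set Q : Set (Fin n → ℝ) := box (fun _ => -1) fun _ => 1 with hQ
  have hQm : MeasurableSet Q := measurableSet_box _ _
  -- This box contains both `x` and the cube `Q`, and its volume is exactly `hypProd x` times that
  -- of `Q`.
  set R : Set (Fin n → ℝ) := box (fun i => -(1 + |x i|)) fun i => 1 + |x i| with hR
  have hlt : ∀ i, -(1 + |x i|) < 1 + |x i| := fun i => by linarith [abs_nonneg (x i)]
  have hxR : x ∈ R := fun i _ => ⟨by linarith [neg_abs_le (x i)], by linarith [le_abs_self (x i)]⟩
  refine le_trans ?_ (le_iSup₂_of_le (f := fun (R : Set (Fin n → ℝ)) (_ : IsRectangle R) =>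
    ⨆ _ : x ∈ R, ⨍⁻ y in R, ‖Q.indicator (fun _ => (1 : ℝ)) y‖ₑ ∂volume) R
    (isRectangle_box hlt) (le_iSup_of_le hxR le_rfl))
  have hQR : Q ⊆ R := Set.pi_mono fun i _ => Set.Ioo_subset_Ioo
    (by linarith [abs_nonneg (x i)]) (by linarith [abs_nonneg (x i)])
  have : ∀ y, ‖Q.indicator (fun _ => (1 : ℝ)) y‖ₑ = Q.indicator 1 y := fun y => by
    by_cases hy : y ∈ Q <;> simp [hy]
  simp_rw [this]
  have hs0 : (hypProd x : ℝ≥0∞) ≠ 0 := by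
    have := one_pos.trans_le (one_le_hypProd x)
    simpa using this.ne'
  have hvol : volume R = hypProd x * volume Q := by
    rw [hR, hQ, volume_box, volume_box, ← ENNReal.ofReal_coe_nnreal, coe_hypProd,
      ENNReal.ofReal_prod_of_nonneg (fun i _ => by positivity), ← Finset.prod_mul_distrib]
    refine Finset.prod_congr rfl fun i _ => ?_
    rw [← ENNReal.ofReal_mul (by positivity)]
    congr 1; ring
  have hQ0 : volume Q ≠ 0 := volume_box_ne_zero fun _ => by norm_num
  have hQt : volume Q ≠ ⊤ := volume_box_ne_top _ _
  rw [setLAverage_eq, lintegral_indicator_one hQm, Measure.restrict_apply hQm,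
    Set.inter_eq_left.2 hQR, hvol, ENNReal.le_div_iff_mul_le (Or.inl (mul_ne_zero hs0 hQ0))
    (Or.inl (ENNReal.mul_ne_top (by simp) hQt)), ← mul_assoc,
    ENNReal.inv_mul_cancel hs0 (by simp), one_mul]

theorem IsYoung.lintegral_lt_top {Φ : ℝ≥0 → ℝ≥0} (hΦ : IsYoung Φ) {n : ℕ} {p : ℝ} (hp : 0 < p)
    (h : StrongMaximalBounded p (fun x : Fin n → ℝ => hΦ.orderIso.symm (hypProd x)) sqProd) :
    ∫⁻ x : Fin n → ℝ, ((hΦ.orderIso.symm (hypProd x) / hypProd x : ℝ≥0) : ℝ≥0∞) ^ p < ⊤ := by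
  obtain ⟨C, hC⟩ := h
  set Q : Set (Fin n → ℝ) := box (fun _ => -1) fun _ => 1 with hQ
  have hQm : MeasurableSet Q := measurableSet_box _ _
  have h1 := hC (Q.indicator fun _ => 1) (measurable_const.indicator hQm)
    (fun x => Set.indicator_nonneg (fun _ _ => zero_le_one) x)
  refine (le_trans ?_ h1).trans_lt (ENNReal.mul_lt_top (by simp) ?_)
  · refine lintegral_mono fun x => ENNReal.rpow_le_rpow ?_ hp.le
    have hs0 : hypProd x ≠ 0 := (one_pos.trans_le (one_le_hypProd x)).ne'
    rw [ENNReal.coe_div hs0, div_eq_mul_inv]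
    gcongr
    exact inv_hypProd_le_strongMaximal x
  · have hpt : ∀ x : Fin n → ℝ, ((sqProd x : ℝ≥0∞) *
        ENNReal.ofReal (Q.indicator (fun _ => (1 : ℝ)) x)) ^ p ≤
          Q.indicator (fun _ => ((2 ^ n : ℝ≥0) : ℝ≥0∞) ^ p) x := by
      intro x
      by_cases hx : x ∈ Q
      · simp only [Set.indicator_of_mem hx, ENNReal.ofReal_one, mul_one]
        refine ENNReal.rpow_le_rpow (ENNReal.coe_le_coe.2 ?_) hp.le
        calc sqProd x ≤ ∏ _i : Fin n, 2 := by
              refine Finset.prod_le_prod' fun i _ => ?_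
              have h2 : ‖x i‖₊ ≤ 1 := by
                rw [← NNReal.coe_le_coe, coe_nnnorm, Real.norm_eq_abs, abs_le]
                exact ⟨(hx i trivial).1.le, (hx i trivial).2.le⟩
              calc 1 + ‖x i‖₊ ^ 2 ≤ 1 + 1 := by gcongr; exact pow_le_one₀ zero_le h2
                _ = 2 := by norm_num
          _ = _ := by simp
      · simp [hx, hp]
    refine (lintegral_mono hpt).trans_lt ?_
    rw [lintegral_indicator hQm, setLIntegral_const]
    exact ENNReal.mul_lt_top (ENNReal.rpow_lt_top_of_nonneg hp.le (by simp))
      (volume_box_ne_top _ _).lt_top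

theorem IsYoung.strongBp_of_lintegral_lt_top {Φ : ℝ≥0 → ℝ≥0} (hΦ : IsYoung Φ) {n : ℕ}
    (hn : 1 ≤ n) {p : ℝ} (hp : 0 < p)
    (h : ∫⁻ x : Fin n → ℝ, ((hΦ.orderIso.symm (hypProd x) / hypProd x : ℝ≥0) : ℝ≥0∞) ^ p < ⊤) :
    StrongBp n p (complementary Φ) := by
  obtain ⟨C, hC⟩ := exists_logBump_le_volume_hypProd_lt hn
  obtain ⟨b, hb, hbig⟩ := exists_complementary_ge Φ 4
  have hb' : (0 : ℝ) < b := hb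
  -- Beyond `b` one has `Φ̄ ≥ 4`, as the volume bound for hyperbolic regions requires.
  refine ⟨b, hb', ?_⟩
  set W : (Fin n → ℝ) → ℝ≥0 := fun x => hΦ.orderIso.symm (hypProd x) / hypProd x
  have hWm : Measurable fun x => (W x : ℝ≥0∞) := by
    have h1 : Measurable fun x : Fin n → ℝ => hΦ.orderIso.symm (hypProd x) :=
      (hΦ.orderIso.symm.continuous.comp continuous_hypProd).measurable
    exact (h1.div continuous_hypProd.measurable).coe_nnreal_ennreal
  let H : ℝ → ℝ≥0∞ := fun r => volume {x | ENNReal.ofReal (1 / r) < W x}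
  -- If `W x ≤ 1 / r`, then `a = Φ⁻¹(hypProd x)` satisfies `r a ≤ Φ(a)`, hence `Φ̄(r) ≤ hypProd x`.
  -- So the region `hypProd x < Φ̄(r)` lies in the level set of `W`.
  have hH : ∀ r ∈ Set.Ioi (b : ℝ), logBump n (complementary Φ r.toNNReal) ≤ C * H r := by
    intro r hr
    have hr0 : 0 < r := hb'.trans hr
    have hbr : b ≤ r.toNNReal := by
      rw [Real.le_toNNReal_iff_coe_le hr0.le]; exact le_of_lt hr
    refine (hC _ (by simpa using hbig _ hbr)).trans ?_
    gcongr
    refine measure_mono fun x hx => ?_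
    change ENNReal.ofReal (1 / r) < W x
    change (hypProd x : ℝ≥0∞) < complementary Φ r.toNNReal at hx
    by_contra hle
    have hs0 : 0 < hypProd x := one_pos.trans_le (one_le_hypProd x)
    refine absurd hx (not_lt.2 ?_)
    have h1 : W x ≤ (1 / r).toNNReal := ENNReal.coe_le_coe.1 (not_lt.1 hle)
    have h2 : r.toNNReal * hΦ.orderIso.symm (hypProd x) ≤ hypProd x := by
      rw [div_le_iff₀ hs0] at h1
      calc _ ≤ r.toNNReal * ((1 / r).toNNReal * hypProd x) := by gcongr
        _ = hypProd x := by
          rw [← mul_assoc, ← Real.toNNReal_mul hr0.le, mul_one_div_cancel hr0.ne']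
          simp
    have h3 := hΦ.complementary_le (a := hΦ.orderIso.symm (hypProd x)) (r := r.toNNReal)
      (hΦ.orderIso_symm_pos hs0) (by rwa [hΦ.map_orderIso_symm])
    rwa [hΦ.map_orderIso_symm] at h3
  have hfin : ∫⁻ r in Set.Ioi (b : ℝ), H r * ENNReal.ofReal (p * r ^ (-p - 1)) < ⊤ := by
    have h1 := lintegral_comp_const_div (p := p) zero_le_one hb' hp H
    rw [Real.one_rpow, ENNReal.ofReal_one, one_mul] at h1
    rw [← h1]
    refine lt_of_le_of_lt ?_ h
    rw [lintegral_rpow_eq_lintegral_meas_lt _ hp hWm]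
    refine lintegral_mono fun t => ?_
    gcongr
    split_ifs
    · simp only [H, one_div_one_div]
      exact le_rfl
    · exact zero_le
  have hle : ∀ r ∈ Set.Ioi (b : ℝ),
      logBump n (complementary Φ r.toNNReal) / ENNReal.ofReal (r ^ p) / ENNReal.ofReal r ≤
        C * ENNReal.ofReal p⁻¹ * (H r * ENNReal.ofReal (p * r ^ (-p - 1))) := by
    intro r hr
    have hr0 : 0 < r := hb'.trans hr
    have e : ENNReal.ofReal p⁻¹ * ENNReal.ofReal (p * r ^ (-p - 1)) =
        (ENNReal.ofReal (r ^ p))⁻¹ * (ENNReal.ofReal r)⁻¹ := by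
      rw [← ENNReal.ofReal_mul (by positivity), ← mul_assoc, inv_mul_cancel₀ hp.ne', one_mul,
        ← ENNReal.ofReal_inv_of_pos (by positivity), ← ENNReal.ofReal_inv_of_pos hr0,
        ← ENNReal.ofReal_mul (by positivity), Real.rpow_sub hr0, Real.rpow_neg hr0.le,
        Real.rpow_one, div_eq_mul_inv]
    calc _ = logBump n (complementary Φ r.toNNReal) *
          ((ENNReal.ofReal (r ^ p))⁻¹ * (ENNReal.ofReal r)⁻¹) := by
          simp only [div_eq_mul_inv]; ring
      _ ≤ C * H r * ((ENNReal.ofReal (r ^ p))⁻¹ * (ENNReal.ofReal r)⁻¹) := by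
          gcongr; exact hH r hr
      _ = _ := by rw [← e]; ring
  refine (setLIntegral_mono' measurableSet_Ioi hle).trans_lt ?_
  rw [lintegral_const_mul' _ _ (ENNReal.mul_ne_top (by simp) (by simp))]
  exact ENNReal.mul_lt_top (ENNReal.mul_lt_top (by simp) (by simp)) hfin

end TwoWeight

end

open TwoWeight

theorem theorem1p1 (n : ℕ) (hn : 1 ≤ n) (p : ℝ) (hp : 1 < p)
    (Φ : ℝ≥0 → ℝ≥0) (hΦ : IsYoung Φ) :
    (StrongBp n p (complementary Φ) →
      ∀ u v : (Fin n → ℝ) → ℝ≥0, IsWeight u → IsWeight v →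
        ConditionA (fun x => (u x : ℝ≥0∞) ^ p) → BumpCondition p Φ u v →
        StrongMaximalBounded p u v) ∧
    ((∀ u v : (Fin n → ℝ) → ℝ≥0, IsWeight u → IsWeight v →
        BumpCondition p Φ u v → StrongMaximalBounded p u v) →
      StrongBp n p (complementary Φ)) := by
  have hp0 : 0 < p := by linarith
  refine ⟨fun h u v hu hv hA hbump =>
    strongMaximalBounded_of_strongBp hn hp0 h hu.1 hv.1 hA hbump, fun h => ?_⟩
  exact hΦ.strongBp_of_lintegral_lt_top hn hp0 (hΦ.lintegral_lt_top hp0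
    (h _ _ (isWeight_of_continuous (hΦ.orderIso.symm.continuous.comp continuous_hypProd))
      (isWeight_of_continuous continuous_sqProd) (hΦ.bumpCondition hp0)))
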